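/- Let $\Sigma\subset\mathbb R^s$ be a closed (compact, without boundary) smooth oriented embedded surface with the induced Riemannian metric, Levi-Civita connection $\nabla$ and area measure $dvol_\Sigma$. Let $p$ be a positive even integer and let $k,M\ge 0$ be integers. Let $L^p_k(\Sigma,\mathbb R^M)$ be the Sobolev space obtained by completing $C^\infty(\Sigma,\mathbb R^M)$ in the norm $$\|f\|_{k,p}=\Big(\sum_{i=0}^k\int_\Sigma|\nabla^i f|^p\,dvol_\Sigma\Big)^{1/p},$$ where $|\cdot|$ is the Euclidean norm on tensors induced by the metric, and let $N_k(f)=\|f\|_{k,p}^p=\sum_{i=0}^k\int_\Sigma|\nabla^i f|^p\,dvol_\Sigma$. Let $G_e$ be an open subset of some $\mathbb R^n$ (for instance a ball), and let $\phi:G_e\times\Sigma\to\Sigma$, $(g,x)\mapsto\phi_g(x)$, be a $C^\infty$ map such that every $\phi_g$ is an orientation-preserving diffeomorphism of $\Sigma$ (the maps $\phi_g$ need not form a group action). Then for every $g\in G_e$ the composition $f\mapsto f\circ\phi_g$ is a well-defined bounded linear operator on $L^p_k(\Sigma,\mathbb R^M)$ (there is exactly one bounded linear operator on $L^p_k(\Sigma,\mathbb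 R^M)$ that sends every $f$ to a function equal to $f\circ\phi_g$ almost everywhere and every smooth $h$ to the smooth function $h\circ\phi_g$), and the function $$F_k:G_e\times L^p_k(\Sigma,\mathbb R^M)\to\mathbb R,\qquad F_k(g,f)=N_k(f\circ\phi_g),$$ is of class $C^\infty$ on $G_e\times L^p_k(\Sigma,\mathbb R^M)$ in the sense of Fréchet derivatives. -/

import Mathlib

open MeasureTheory Set
open scoped ENNReal ContDiff RealInnerProductSpace

noncomputable section

/-- Euclidean space `ℝ^d` with the Euclidean norm. -/
abbrev Eu (d : ℕ) : Type := EuclideanSpace ℝ (Fin d)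

/-! ### Closed surfaces embedded in Euclidean space -/

/-- `ψ : V → S` is a smooth local parametrization of `S ⊆ ℝ^s` by an open set `V ⊆ ℝ²`:
a smooth injective immersion that is a homeomorphism onto a relatively open subset of `S`. -/
structure IsLocalParam {s : ℕ} (S : Set (Eu s)) (V : Set (Eu 2)) (ψ : Eu 2 → Eu s) : Prop where
  isOpen : IsOpen V
  smooth : ContDiffOn ℝ ∞ ψ V
  immersion : ∀ y ∈ V, Function.Injective (fderiv ℝ ψ y)
  injOn : InjOn ψ V
  open_image : ∀ W ⊆ V, IsOpen W → ∃ O : Set (Eu s), IsOpen O ∧ ψ '' W = S ∩ O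

/-- `S` is a closed (compact, without boundary) smooth surface embedded in `ℝ^s`. -/
structure IsClosedSurface {s : ℕ} (S : Set (Eu s)) : Prop where
  isCompact : IsCompact S
  exists_param : ∀ x ∈ S, ∃ (V : Set (Eu 2)) (ψ : Eu 2 → Eu s), IsLocalParam S V ψ ∧ x ∈ ψ '' V

/-- The tangent plane `T_x S`, as a linear subspace of `ℝ^s`. -/
def tangentPlane {s : ℕ} (S : Set (Eu s)) (x : Eu s) : Submodule ℝ (Eu s) :=
  Submodule.span ℝ (tangentConeAt ℝ S x)

/-- The orthogonal projection `P_x : ℝ^s → T_x S ⊆ ℝ^s`. -/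
def tangentProj {s : ℕ} (S : Set (Eu s)) (x : Eu s) : Eu s →L[ℝ] Eu s :=
  (tangentPlane S x).starProjection

/-- The area density `√det (⟪∂_a ψ, ∂_b ψ⟫)` of the induced metric in a parametrization `ψ`. -/
def areaDensity {s : ℕ} (ψ : Eu 2 → Eu s) (y : Eu 2) : ℝ≥0∞ :=
  ENNReal.ofReal (Real.sqrt (Matrix.det (Matrix.of fun a b : Fin 2 =>
    ⟪fderiv ℝ ψ y (EuclideanSpace.single a 1), fderiv ℝ ψ y (EuclideanSpace.single b 1)⟫)))

/-- The Riemannian area measure `dvol_S` of the induced metric, as a measure on `ℝ^s` carried by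
`S`: the least measure dominating the area measure `ψ_*(√det(g_ab) dy)` of every local
parametrization.  As these measures agree on overlaps, it restricts to each of them. -/
def areaMeasure {s : ℕ} (S : Set (Eu s)) : Measure (Eu s) :=
  ⨆ c : {c : Set (Eu 2) × (Eu 2 → Eu s) // IsLocalParam S c.1 c.2},
    ((volume.restrict c.1.1).withDensity (areaDensity c.1.2)).map c.1.2

/-- An orientation of `S`, given by a continuous area form `o` vanishing nowhere on `S`. -/
structure IsOrientation {s : ℕ} (S : Set (Eu s)) (o : Eu s → Eu s [⋀^Fin 2]→L[ℝ] ℝ) : Prop where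
  continuousOn : ContinuousOn o S
  ne_zero : ∀ x ∈ S, ∃ v ∈ tangentPlane S x, ∃ w ∈ tangentPlane S x, o x ![v, w] ≠ 0

/-- `φ` restricts to a smooth diffeomorphism `S → S`. -/
structure IsDiffeoOf {s : ℕ} (S : Set (Eu s)) (φ : Eu s → Eu s) : Prop where
  smooth : ContDiffOn ℝ ∞ φ S
  mapsTo : MapsTo φ S S
  exists_inv : ∃ θ : Eu s → Eu s, ContDiffOn ℝ ∞ θ S ∧ MapsTo θ S S ∧ InvOn θ φ S S

/-- `φ : S → S` preserves the orientation given by `o`: its differential maps positively oriented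
bases of `T_x S` to positively oriented bases of `T_{φ x} S`. -/
def PreservesOrientation {s : ℕ} (S : Set (Eu s)) (o : Eu s → Eu s [⋀^Fin 2]→L[ℝ] ℝ)
    (φ : Eu s → Eu s) : Prop :=
  ∀ x ∈ S, ∀ v ∈ tangentPlane S x, ∀ w ∈ tangentPlane S x, 0 < o x ![v, w] →
    0 < o (φ x) ![fderivWithin ℝ φ S x v, fderivWithin ℝ φ S x w]

/-! ### Iterated covariant derivatives -/

/-- The Levi-Civita covariant derivative of an `ℝ^M`-valued tangential covariant `i`-tensor `T`
on `S ⊆ ℝ^s` for the induced metric: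
`(∇T)_x (v₀, …, v_i) = (D_{P v₀} T)_x (P v₁, …, P v_i)` with `P = P_x`.
Tensors on `T_x S` are extended to `ℝ^s` by precomposition with `P_x`; the value does not depend on
the derivative within `S` that `fderivWithin` picks, as it is only used on tangent vectors. -/
def covDeriv {s M i : ℕ} (S : Set (Eu s)) (T : Eu s → Eu s [×i]→L[ℝ] Eu M) (x : Eu s) :
    Eu s [×(i + 1)]→L[ℝ] Eu M :=
  (ContinuousLinearMap.uncurryLeft (fderivWithin ℝ T S x)).compContinuousLinearMap
    (fun _ => tangentProj S x)

/-- The iterated covariant derivative `∇^i f` of `f : S → ℝ^M`. -/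
def iterCovDeriv {s M : ℕ} (S : Set (Eu s)) (f : Eu s → Eu M) :
    (i : ℕ) → Eu s → Eu s [×i]→L[ℝ] Eu M
  | 0 => fun x => ContinuousMultilinearMap.uncurry0 ℝ (Eu s) (f x)
  | i + 1 => covDeriv S (iterCovDeriv S f i)

/-- Components of `ℝ^M`-valued `i`-tensors in the standard basis of `ℝ^s`.  The norm is the tensor
(Hilbert-Schmidt) norm `|T|² = ∑_J |T_J|²`; on tensors extended from `T_x S` by `P_x` it is the
norm induced by the inner product of `T_x S`. -/
abbrev TensorComp (s M i : ℕ) : Type := PiLp 2 (fun _ : Fin i → Fin s => Eu M)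

/-- The components `T (e_{J 0}, …, e_{J (i-1)})` of an `i`-tensor. -/
def tensorComp {s M i : ℕ} (T : Eu s [×i]→L[ℝ] Eu M) : TensorComp s M i :=
  WithLp.toLp 2 fun J => T fun a => EuclideanSpace.single (J a) 1

/-! ### The Sobolev space `L^p_k(S, ℝ^M)` -/

/-- Families `(u₀, …, u_k)` of `L^p` tensor fields of orders `0, …, k`, with the norm
`(∑_{i ≤ k} ∫_S |u_i|^p dvol)^{1/p}`. -/
abbrev TensorJets {s : ℕ} (S : Set (Eu s)) (k p M : ℕ) [Fact (1 ≤ (p : ℝ≥0∞))] : Type :=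
  PiLp (p : ℝ≥0∞) (fun i : Fin (k + 1) => Lp (TensorComp s M i) (p : ℝ≥0∞) (areaMeasure S))

/-- `u = (h, ∇h, …, ∇^k h)` almost everywhere on `S`. -/
def IsJetOf {s k p M : ℕ} {S : Set (Eu s)} [Fact (1 ≤ (p : ℝ≥0∞))]
    (u : TensorJets S k p M) (h : Eu s → Eu M) : Prop :=
  ∀ i : Fin (k + 1), u i =ᵐ[areaMeasure S] fun x => tensorComp (iterCovDeriv S h i x)

/-- `L^p_k(S, ℝ^M)`: the completion of `C^∞(S, ℝ^M)` in the norm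
`‖h‖_{k,p} = (∑_{i ≤ k} ∫_S |∇^i h|^p dvol)^{1/p}`, realized by identifying `f` with the family
`(f, ∇f, …, ∇^k f)` of its (weak) covariant derivatives.  (On a closed surface the families coming
from smooth functions already form a linear subspace, so the span only adds its closure
properties.) -/
def sobolevSubmodule {s : ℕ} (S : Set (Eu s)) (k p M : ℕ) [Fact (1 ≤ (p : ℝ≥0∞))] :
    Submodule ℝ (TensorJets S k p M) :=
  (Submodule.span ℝ {u : TensorJets S k p M |
    ∃ h : Eu s → Eu M, ContDiffOn ℝ ∞ h S ∧ IsJetOf u h}).topologicalClosure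

/-- The normed space `L^p_k(S, ℝ^M)`. -/
abbrev Sobolev {s : ℕ} (S : Set (Eu s)) (k p M : ℕ) [Fact (1 ≤ (p : ℝ≥0∞))] : Type :=
  ↥(sobolevSubmodule S k p M)

/-- The function `S → ℝ^M` (up to null sets) underlying an element of `L^p_k(S, ℝ^M)`. -/
def Sobolev.fn {s k p M : ℕ} {S : Set (Eu s)} [Fact (1 ≤ (p : ℝ≥0∞))]
    (f : Sobolev S k p M) (x : Eu s) : Eu M :=
  (f.1 (0 : Fin (k + 1)) x) Fin.elim0

/-- `N_k(f) = ∑_{i ≤ k} ∫_S |∇^i f|^p dvol`, the `p`-th power of the `L^p_k`-norm. -/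
def sobolevN {s k p M : ℕ} {S : Set (Eu s)} [Fact (1 ≤ (p : ℝ≥0∞))]
    (f : Sobolev S k p M) : ℝ :=
  ∑ i : Fin (k + 1), ∫ x, ‖f.1 i x‖ ^ p ∂(areaMeasure S)

/-- `A` is the composition operator `f ↦ f ∘ φ` on `L^p_k(S, ℝ^M)`: a bounded operator with
`A f = f ∘ φ` almost everywhere for all `f`, and mapping (the jet of) a smooth `h` to (the jet of)
the smooth function `h ∘ φ`. -/
structure IsCompositionOperator {s k p M : ℕ} {S : Set (Eu s)} [Fact (1 ≤ (p : ℝ≥0∞))]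
    (φ : Eu s → Eu s) (A : Sobolev S k p M →L[ℝ] Sobolev S k p M) : Prop where
  fn_eq : ∀ f : Sobolev S k p M, (A f).fn =ᵐ[areaMeasure S] fun x => f.fn (φ x)
  jet_eq : ∀ (f : Sobolev S k p M) (h : Eu s → Eu M), ContDiffOn ℝ ∞ h S →
    IsJetOf f.1 h → IsJetOf (A f).1 (h ∘ φ)

end

/-!
Let `μ` be the area measure, `θ_g = φ_g⁻¹` and `u = (f, ∇f, …, ∇^k f)`.  The map
`g ↦ f ∘ φ_g ∈ L^p_k` is only continuous for a general `f`, so the smoothness of `N_k(f ∘ φ_g)`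
cannot come from it.  It comes from a change of variables that moves all dependence on `g` into
smooth coefficients.

* By the chain rule (`CovariantTower.exists_jet_comp`), `∇^i (h ∘ φ_g)` at `x` is
  `∑_{j ≤ i} C_ij(g, x) (∇^j h)(φ_g x)` with `C_ij` smooth on `G × S` and independent of `h`.  The
  induction step differentiates this formula; the flat derivative of `∇^j h` differs from
  `∇^{j+1} h` by a term of order zero in `∇^j h`, since `∇^j h` is its own tangential projection.
  With `C_ij` the right-hand side defines a bounded operator on all families `u` of `L^p` tensor
  fields, which preserves `L^p_k` and is determined there by its values on smooth functions.
* The inverses `θ_g y` are smooth in `(g, y)` (`IsClosedSurface.contDiffOn_invFunOn`), and `φ_g`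
  pushes `μ` forward to `J_g μ`, where `J_g > 0` is the area distortion of `θ_g`, smooth in `(g, y)`
  (`IsClosedSurface.map_areaMeasure`).  Since `J_g` is the absolute value of a
  Jacobian determinant, this needs no orientation.
* Hence `N_k(f ∘ φ_g) = ∑_i ∫ |∑_j K_ij(g, y) u_j(y)|^p dμ(y)` with
  `K_ij(g, y) = J_g(y)^{1/p} C_ij(g, θ_g y)`.  As `S` is compact, `g ↦ K_ij(g, ·)` is a smooth curve
  in `C(S, Hom)` (`contDiffOn_toContinuousMapOn`); multiplication `C(S, Hom) × L^p → L^p` is bounded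
  bilinear; and as `p` is even, `v ↦ ∫ |v|^p dμ` is the diagonal of a bounded `p`-linear form on
  `L^p`, by Hölder's inequality (`contDiff_integral_norm_pow`).  So the composite is smooth.

Throughout, `S` has no unique differentials as a subset of `ℝ^s`: `fderivWithin` picks some
derivative within `S`, and only its values on the tangent plane are determined.
-/

open Filter Topology

/-! ### Local parametrizations and the tangent plane -/

/-- A derivative within `S` is determined on the span of the tangent cone, although `S` need not
have unique differentials. -/
theorem HasFDerivWithinAt.eqOn_span_tangentCone {E F : Type*} [NormedAddCommGroup E]
    [NormedSpace ℝ E] [NormedAddCommGroup F] [NormedSpace ℝ F] {f : E → F} {f' f₁' : E →L[ℝ] F}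
    {S : Set E} {x : E} (h : HasFDerivWithinAt f f' S x) (h₁ : HasFDerivWithinAt f f₁' S x) {v : E}
    (hv : v ∈ Submodule.span ℝ (tangentConeAt ℝ S x)) : f' v = f₁' v :=
  LinearMap.eqOn_span (f := f'.toLinearMap) (g := f₁'.toLinearMap) (h.unique_on h₁) hv

theorem HasFDerivWithinAt.fderivWithin_apply_of_mem {s : ℕ} {F : Type*} [NormedAddCommGroup F]
    [NormedSpace ℝ F] {f : Eu s → F} {f' : Eu s →L[ℝ] F} {S : Set (Eu s)} {x : Eu s}
    (h : HasFDerivWithinAt f f' S x) {v : Eu s} (hv : v ∈ tangentPlane S x) :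
    fderivWithin ℝ f S x v = f' v :=
  h.differentiableWithinAt.hasFDerivWithinAt.eqOn_span_tangentCone h hv

theorem HasFDerivWithinAt.map_tangentPlane {s : ℕ} {f : Eu s → Eu s} {f' : Eu s →L[ℝ] Eu s}
    {S : Set (Eu s)} {x : Eu s} (h : HasFDerivWithinAt f f' S x) (hf : MapsTo f S S)
    {v : Eu s} (hv : v ∈ tangentPlane S x) : f' v ∈ tangentPlane S (f x) := by
  have h1 : tangentPlane S x ≤ (tangentPlane S (f x)).comap f'.toLinearMap := by
    refine Submodule.span_le.2 fun w hw => ?_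
    exact Submodule.subset_span (tangentConeAt_mono hf.image_subset (h.mapsTo_tangent_cone hw))
  exact h1 hv

theorem tangentProj_mem {s : ℕ} (S : Set (Eu s)) (x v : Eu s) :
    tangentProj S x v ∈ tangentPlane S x :=
  Submodule.starProjection_apply_mem _ _

theorem tangentProj_of_mem {s : ℕ} {S : Set (Eu s)} {x v : Eu s} (hv : v ∈ tangentPlane S x) :
    tangentProj S x v = v :=
  Submodule.starProjection_eq_self_iff.2 hv

theorem ContinuousLinearMap.exists_leftInverse_of_finiteDimensional {E F : Type*}
    [NormedAddCommGroup E] [NormedSpace ℝ E] [NormedAddCommGroup F] [NormedSpace ℝ F]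
    [FiniteDimensional ℝ F] {f : E →L[ℝ] F} (hf : Function.Injective f) :
    ∃ l : F →L[ℝ] E, ∀ x, l (f x) = x := by
  obtain ⟨l, hl⟩ := LinearMap.exists_leftInverse_of_injective f.toLinearMap
    (LinearMap.ker_eq_bot.2 hf)
  exact ⟨LinearMap.toContinuousLinearMap l, fun x => LinearMap.congr_fun hl x⟩

namespace IsLocalParam

variable {s : ℕ} {S : Set (Eu s)} {V : Set (Eu 2)} {ψ : Eu 2 → Eu s} {a : Eu 2}

theorem contDiffAt (h : IsLocalParam S V ψ) (ha : a ∈ V) : ContDiffAt ℝ ∞ ψ a :=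
  h.smooth.contDiffAt (h.isOpen.mem_nhds ha)

theorem hasFDerivAt (h : IsLocalParam S V ψ) (ha : a ∈ V) :
    HasFDerivAt ψ (fderiv ℝ ψ a) a :=
  ((h.contDiffAt ha).differentiableAt (by simp)).hasFDerivAt

theorem image_subset (h : IsLocalParam S V ψ) : ψ '' V ⊆ S := by
  obtain ⟨O, -, hO⟩ := h.open_image V subset_rfl h.isOpen
  rw [hO]; exact inter_subset_left

theorem mapsTo (h : IsLocalParam S V ψ) : MapsTo ψ V S := fun _ hx =>
  h.image_subset (mem_image_of_mem _ hx)

theorem image_mem_nhdsWithin (h : IsLocalParam S V ψ) {W : Set (Eu 2)} (hW : W ∈ 𝓝 a)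
    (ha : a ∈ V) : ψ '' (V ∩ W) ∈ 𝓝[S] (ψ a) := by
  have hVW : V ∩ interior W ⊆ V := inter_subset_left
  obtain ⟨O, hO, hOe⟩ := h.open_image (V ∩ interior W) hVW (h.isOpen.inter isOpen_interior)
  have hm : ψ a ∈ ψ '' (V ∩ interior W) := mem_image_of_mem _ ⟨ha, mem_interior_iff_mem_nhds.2 hW⟩
  rw [hOe] at hm
  have h1 : S ∩ O ∈ 𝓝[S] (ψ a) :=
    inter_mem self_mem_nhdsWithin (mem_nhdsWithin_of_mem_nhds (hO.mem_nhds hm.2))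
  rw [← hOe] at h1
  exact mem_of_superset h1 (image_mono (inter_subset_inter_right _ interior_subset))

theorem invFunOn_apply (h : IsLocalParam S V ψ) (ha : a ∈ V) :
    Function.invFunOn ψ V (ψ a) = a :=
  h.injOn.leftInvOn_invFunOn ha

theorem eventually_apply_invFunOn (h : IsLocalParam S V ψ) (ha : a ∈ V) :
    ∀ᶠ y in 𝓝[S] (ψ a), Function.invFunOn ψ V y ∈ V ∧ ψ (Function.invFunOn ψ V y) = y := by
  filter_upwards [h.image_mem_nhdsWithin univ_mem ha] with y hy
  rw [inter_univ] at hy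
  exact ⟨Function.invFunOn_mem hy, Function.invFunOn_eq hy⟩

/-- Composing `ψ` with a linear left inverse of its differential gives a local diffeomorphism of the
plane, whose local inverse yields the smoothness of the chart `ψ⁻¹`. -/
theorem contDiffWithinAt_invFunOn (h : IsLocalParam S V ψ) (ha : a ∈ V) :
    ContDiffWithinAt ℝ ∞ (Function.invFunOn ψ V) S (ψ a) := by
  obtain ⟨L, hl⟩ := ContinuousLinearMap.exists_leftInverse_of_finiteDimensional (h.immersion a ha)
  have hL : L.comp (fderiv ℝ ψ a) = ContinuousLinearMap.id ℝ (Eu 2) := by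
    ext1 v
    exact hl v
  have hf : ContDiffAt ℝ ∞ (L ∘ ψ) a := L.contDiff.contDiffAt.comp a (h.contDiffAt ha)
  have hf' : HasFDerivAt (L ∘ ψ) ((ContinuousLinearEquiv.refl ℝ (Eu 2) : Eu 2 ≃L[ℝ] Eu 2) :
      Eu 2 →L[ℝ] Eu 2) a := by
    have := L.hasFDerivAt.comp a (h.hasFDerivAt ha)
    rw [hL] at this
    exact this
  have hn : (∞ : ℕ∞ω) ≠ 0 := by simp
  let κ := hf.localInverse hf' hn
  have hκ : ContDiffAt ℝ ∞ κ (L (ψ a)) := hf.to_localInverse hf' hn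
  have hev : ∀ᶠ b in 𝓝 a, κ (L (ψ b)) = b :=
    (hf.hasStrictFDerivAt' hf' hn).eventually_left_inverse
  have hc : ContDiffAt ℝ ∞ (κ ∘ L) (ψ a) := hκ.comp (ψ a) L.contDiff.contDiffAt
  have hS : ψ a ∈ S := h.mapsTo ha
  refine hc.contDiffWithinAt.congr_of_eventuallyEq_of_mem ?_ hS
  filter_upwards [h.image_mem_nhdsWithin hev ha]
  rintro _ ⟨b, hb, rfl⟩
  rw [h.invFunOn_apply hb.1]
  exact hb.2.symm

theorem tangentPlane_eq (h : IsLocalParam S V ψ) (ha : a ∈ V) :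
    tangentPlane S (ψ a) = LinearMap.range (fderiv ℝ ψ a).toLinearMap := by
  apply le_antisymm
  · refine Submodule.span_le.2 fun v hv => ?_
    have h1 : HasFDerivWithinAt (fun y => y) (ContinuousLinearMap.id ℝ (Eu s)) S (ψ a) :=
      hasFDerivWithinAt_id _ _
    have h2 : HasFDerivWithinAt (Function.invFunOn ψ V)
        (fderivWithin ℝ (Function.invFunOn ψ V) S (ψ a)) S (ψ a) :=
      ((h.contDiffWithinAt_invFunOn ha).differentiableWithinAt (by simp)).hasFDerivWithinAt
    have h3 : HasFDerivWithinAt (ψ ∘ Function.invFunOn ψ V) _ S (ψ a) :=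
      HasFDerivAt.comp_hasFDerivWithinAt (ψ a) (g := ψ) (g' := fderiv ℝ ψ a)
      (by rw [h.invFunOn_apply ha]; exact h.hasFDerivAt ha) h2
    have h4 := h3.congr_of_eventuallyEq (f₁ := fun y => y)
      ((h.eventually_apply_invFunOn ha).mono fun y hy => hy.2.symm)
      (by simp [h.invFunOn_apply ha])
    have h5 := h1.unique_on h4 hv
    exact ⟨_, h5.symm⟩
  · rintro _ ⟨v, rfl⟩
    refine Submodule.subset_span (tangentConeAt_mono h.image_subset ?_)
    refine (h.hasFDerivAt ha).hasFDerivWithinAt.mapsTo_tangent_cone (s := V) ?_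
    rw [tangentConeAt_of_mem_nhds (h.isOpen.mem_nhds ha)]
    trivial

end IsLocalParam

/-- The adjoint as a continuous linear map, for operators between real Euclidean spaces. -/
noncomputable def adjointL (m d : ℕ) : (Eu m →L[ℝ] Eu d) →L[ℝ] (Eu d →L[ℝ] Eu m) :=
  LinearMap.toContinuousLinearMap
    { toFun := fun B => ContinuousLinearMap.adjoint B
      map_add' := fun B C => by simp
      map_smul' := fun c B => by simp }

theorem adjointL_apply {m d : ℕ} (B : Eu m →L[ℝ] Eu d) :
    adjointL m d B = ContinuousLinearMap.adjoint B := rfl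

theorem isInvertible_adjoint_comp_self {m d : ℕ} {B : Eu m →L[ℝ] Eu d}
    (hB : Function.Injective B) : ((adjointL m d B).comp B).IsInvertible := by
  have hi : Function.Injective ((adjointL m d B).comp B).toLinearMap := by
    rw [← LinearMap.ker_eq_bot, LinearMap.ker_eq_bot']
    intro v hv
    have h1 : ⟪(adjointL m d B) (B v), v⟫ = 0 := by
      have : (adjointL m d B) (B v) = 0 := hv
      rw [this, inner_zero_left]
    rw [adjointL_apply, ContinuousLinearMap.adjoint_inner_left, inner_self_eq_zero] at h1
    exact hB (by rw [h1, map_zero])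
  exact ⟨(LinearEquiv.ofInjectiveEndo _ hi).toContinuousLinearEquiv, by ext1 v; rfl⟩

/-- The projection to the range of an injective `B` is `B (BᵀB)⁻¹ Bᵀ`. -/
theorem starProjection_range_eq {m d : ℕ} {B : Eu m →L[ℝ] Eu d} (hB : Function.Injective B) :
    (LinearMap.range B.toLinearMap).starProjection =
      B.comp ((((adjointL m d B).comp B).inverse).comp (adjointL m d B)) := by
  ext1 v
  apply Submodule.eq_starProjection_of_mem_of_inner_eq_zero
  · exact ⟨_, rfl⟩
  · rintro _ ⟨w, rfl⟩
    have h1 := (isInvertible_adjoint_comp_self hB).self_comp_inverse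
    have h2 := DFunLike.congr_fun h1 (adjointL m d B v)
    simp only [ContinuousLinearMap.comp_apply, ContinuousLinearMap.id_apply] at h2
    simp only [ContinuousLinearMap.comp_apply, ContinuousLinearMap.coe_coe]
    rw [← ContinuousLinearMap.adjoint_inner_left, map_sub, ← adjointL_apply, h2, sub_self,
      inner_zero_left]

section

variable {s : ℕ} {S : Set (Eu s)}

theorem IsLocalParam.contDiffWithinAt_fderiv_invFunOn {V : Set (Eu 2)} {ψ : Eu 2 → Eu s}
    {a : Eu 2} (h : IsLocalParam S V ψ) (ha : a ∈ V) :
    ContDiffWithinAt ℝ ∞ (fun y => fderiv ℝ ψ (Function.invFunOn ψ V y)) S (ψ a) := by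
  refine ContDiffAt.comp_contDiffWithinAt (g := fderiv ℝ ψ) (ψ a) ?_
    (h.contDiffWithinAt_invFunOn ha)
  rw [h.invFunOn_apply ha]
  exact (h.contDiffAt ha).fderiv_right (by simp)

theorem IsClosedSurface.contDiffOn_tangentProj (hS : IsClosedSurface S) :
    ContDiffOn ℝ ∞ (tangentProj S) S := by
  intro x hx
  obtain ⟨V, ψ, h, a, ha, rfl⟩ := hS.exists_param x hx
  have hB := h.contDiffWithinAt_fderiv_invFunOn ha
  have hA := (adjointL 2 s).contDiff.comp_contDiffWithinAt hB
  have hinv : ContDiffWithinAt ℝ ∞ (fun y => ContinuousLinearMap.inverse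
      ((adjointL 2 s (fderiv ℝ ψ (Function.invFunOn ψ V y))).comp
        (fderiv ℝ ψ (Function.invFunOn ψ V y)))) S (ψ a) := by
    refine ContDiffAt.comp_contDiffWithinAt (g := ContinuousLinearMap.inverse) (ψ a) ?_
      (hA.clm_comp hB)
    obtain ⟨e, he⟩ := isInvertible_adjoint_comp_self (h.immersion _ ha)
    rw [h.invFunOn_apply ha, ← he]
    exact contDiffAt_map_inverse e
  refine (hB.clm_comp (hinv.clm_comp hA)).congr_of_eventuallyEq_of_mem ?_ hx
  filter_upwards [h.eventually_apply_invFunOn ha] with y hy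
  rw [Function.comp_apply, ← starProjection_range_eq (h.immersion _ hy.1)]
  have := h.tangentPlane_eq hy.1
  rw [hy.2] at this
  simp only [tangentProj, this]

/-! ### Smoothness of tangential derivatives -/

variable {W F : Type*} [NormedAddCommGroup W] [NormedSpace ℝ W] [NormedAddCommGroup F]
  [NormedSpace ℝ F]

theorem ContDiffOn.exists_hasFDerivWithinAt_contDiffWithinAt {T : Set W} {f : W → F}
    (hf : ContDiffOn ℝ ∞ f T) {z : W} (hz : z ∈ T) (m : ℕ) :
    ∃ f' : W → W →L[ℝ] F, (∀ᶠ y in 𝓝[T] z, HasFDerivWithinAt f (f' y) T y) ∧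
      ContDiffWithinAt ℝ m f' T z := by
  have h1 : ContDiffWithinAt ℝ ((m : ℕ∞ω) + 1) f T z :=
    (hf z hz).of_le (by exact_mod_cast le_top)
  obtain ⟨u, hu, -, -, f', hf', hc⟩ :=
    (contDiffWithinAt_succ_iff_hasFDerivWithinAt' (by simp)).1 h1
  rw [insert_eq_of_mem hz] at hu
  exact ⟨f', mem_of_superset hu hf', hc⟩

/-- The tangential derivative along `S` of a smooth family of functions on `S` is again a smooth
family, whatever derivatives within `S` are picked by `fderivWithin`. -/
theorem IsClosedSurface.contDiffOn_fderivWithin_comp_tangentProj (hS : IsClosedSurface S)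
    {G : Set W} {f : W → Eu s → F} (hf : ContDiffOn ℝ ∞ (fun z : W × Eu s => f z.1 z.2) (G ×ˢ S)) :
    ContDiffOn ℝ ∞ (fun z : W × Eu s => (fderivWithin ℝ (f z.1) S z.2).comp (tangentProj S z.2))
      (G ×ˢ S) := by
  intro z hz
  refine contDiffWithinAt_infty.2 fun m => ?_
  obtain ⟨f', hf', hc⟩ := hf.exists_hasFDerivWithinAt_contDiffWithinAt hz m
  have hP : ContDiffWithinAt ℝ m (fun z : W × Eu s => tangentProj S z.2) (G ×ˢ S) z :=
    (hS.contDiffOn_tangentProj.comp contDiffOn_snd (fun z hz => hz.2) z hz).of_le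
      (by exact_mod_cast le_top)
  have h2 := (hc.clm_comp (contDiffWithinAt_const
    (c := ContinuousLinearMap.inr ℝ W (Eu s)))).clm_comp hP
  refine h2.congr_of_eventuallyEq_of_mem ?_ hz
  filter_upwards [hf', self_mem_nhdsWithin] with y hy hyT
  ext1 v
  have h3 : HasFDerivWithinAt (fun x => f y.1 x)
      ((f' y).comp (ContinuousLinearMap.inr ℝ W (Eu s))) S y.2 :=
    HasFDerivWithinAt.comp (t := G ×ˢ S) (f := fun x => (y.1, x)) y.2 hy
      (hasFDerivAt_prodMk_right y.1 y.2).hasFDerivWithinAt fun x hx => ⟨hyT.1, hx⟩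
  exact h3.fderivWithin_apply_of_mem (tangentProj_mem S y.2 v)

theorem IsClosedSurface.contDiffOn_fderivWithin_comp_tangentProj' (hS : IsClosedSurface S)
    {f : Eu s → F} (hf : ContDiffOn ℝ ∞ f S) :
    ContDiffOn ℝ ∞ (fun x => (fderivWithin ℝ f S x).comp (tangentProj S x)) S := by
  have h := hS.contDiffOn_fderivWithin_comp_tangentProj (W := ℝ) (G := univ) (f := fun _ => f)
    (hf.comp contDiffOn_snd fun z hz => hz.2)
  exact h.comp (f := fun x => ((0 : ℝ), x)) (by fun_prop) fun x hx => ⟨trivial, hx⟩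

theorem contDiffOn_fderiv_left {G : Set W} (hG : IsOpen G) {T : Set (Eu s)} {f : W → Eu s → F}
    (hf : ContDiffOn ℝ ∞ (fun z : W × Eu s => f z.1 z.2) (G ×ˢ T)) :
    ContDiffOn ℝ ∞ (fun z : W × Eu s => fderiv ℝ (fun g => f g z.2) z.1) (G ×ˢ T) := by
  intro z hz
  refine contDiffWithinAt_infty.2 fun m => ?_
  obtain ⟨f', hf', hc⟩ := hf.exists_hasFDerivWithinAt_contDiffWithinAt hz m
  have h2 := hc.clm_comp (contDiffWithinAt_const (c := ContinuousLinearMap.inl ℝ W (Eu s)))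
  refine h2.congr_of_eventuallyEq_of_mem ?_ hz
  filter_upwards [hf', self_mem_nhdsWithin] with y hy hyT
  have h3 : HasFDerivWithinAt (fun g => f g y.2)
      ((f' y).comp (ContinuousLinearMap.inl ℝ W (Eu s))) G y.1 :=
    HasFDerivWithinAt.comp (t := G ×ˢ T) (f := fun g => (g, y.2)) y.1 hy
      (hasFDerivAt_prodMk_left y.1 y.2).hasFDerivWithinAt fun x hx => ⟨hx, hyT.2⟩
  exact (h3.hasFDerivAt (hG.mem_nhds hyT.1)).fderiv

end

/-! ### The chain rule for iterated covariant derivatives -/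

theorem ContDiffOn.hasFDerivWithinAt_infty {E F : Type*} [NormedAddCommGroup E] [NormedSpace ℝ E]
    [NormedAddCommGroup F] [NormedSpace ℝ F] {f : E → F} {T : Set E} (hf : ContDiffOn ℝ ∞ f T)
    {x : E} (hx : x ∈ T) : HasFDerivWithinAt f (fderivWithin ℝ f T x) T x :=
  ((hf x hx).differentiableWithinAt (by simp)).hasFDerivWithinAt

theorem contDiffOn_slice {X Y Z : Type*} [NormedAddCommGroup X] [NormedSpace ℝ X]
    [NormedAddCommGroup Y] [NormedSpace ℝ Y] [NormedAddCommGroup Z] [NormedSpace ℝ Z]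
    {A : Set X} {B : Set Y} {f : X → Y → Z}
    (hf : ContDiffOn ℝ ∞ (fun z : X × Y => f z.1 z.2) (A ×ˢ B)) {a : X} (ha : a ∈ A) :
    ContDiffOn ℝ ∞ (f a) B :=
  hf.comp (f := fun y => (a, y)) (by fun_prop) fun _ hy => ⟨ha, hy⟩

/-- The differential calculus of the bundles of covariant tensors over `S`, reduced to what the
chain rule uses: bundles with fibres `E 0, E 1, …` inside which `Q i x` is the projection to the
tangential tensors at `x`, uncurrying and currying maps `U i` and `K i`, and an assignment `J` of
the iterated covariant derivatives `J h i` to a function `h`. -/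
structure CovariantTower {s : ℕ} (S : Set (Eu s)) {X : Type} (E : ℕ → Type)
    [NormedAddCommGroup X] [NormedSpace ℝ X]
    [∀ i, NormedAddCommGroup (E i)] [∀ i, NormedSpace ℝ (E i)]
    (Q : ∀ i, Eu s → E i →L[ℝ] E i) (U : ∀ i, (Eu s →L[ℝ] E i) →L[ℝ] E (i + 1))
    (K : ∀ i, E (i + 1) →L[ℝ] (Eu s →L[ℝ] E i)) (J : (Eu s → X) → ∀ i, Eu s → E i) : Prop where
  smooth : ∀ i, ContDiffOn ℝ ∞ (Q i) S
  curry_uncurry : ∀ i, ∀ x ∈ S, ∀ T' : Eu s →L[ℝ] E i, ∀ w ∈ tangentPlane S x,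
    K i (Q (i + 1) x (U i (T'.comp (tangentProj S x)))) w = Q i x (T' w)
  jet_succ : ∀ h i x T', HasFDerivWithinAt (J h i) T' S x →
    J h (i + 1) x = Q (i + 1) x (U i (T'.comp (tangentProj S x)))
  proj_jet : ∀ h i x, Q i x (J h i x) = J h i x
  smooth_zero : ∀ h, ContDiffOn ℝ ∞ h S → ContDiffOn ℝ ∞ (J h 0) S
  comp_zero : ∀ (h : Eu s → X) (θ : Eu s → Eu s) x, J (h ∘ θ) 0 x = J h 0 (θ x)

namespace CovariantTower

variable {s : ℕ} {S : Set (Eu s)} {X : Type} {E : ℕ → Type} [NormedAddCommGroup X]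
  [NormedSpace ℝ X] [∀ i, NormedAddCommGroup (E i)] [∀ i, NormedSpace ℝ (E i)]
  {Q : ∀ i, Eu s → E i →L[ℝ] E i} {U : ∀ i, (Eu s →L[ℝ] E i) →L[ℝ] E (i + 1)}
  {K : ∀ i, E (i + 1) →L[ℝ] (Eu s →L[ℝ] E i)} {J : (Eu s → X) → ∀ i, Eu s → E i}

theorem contDiffOn_jet (t : CovariantTower S E Q U K J) (hS : IsClosedSurface S) {h : Eu s → X}
    (hh : ContDiffOn ℝ ∞ h S) (i : ℕ) : ContDiffOn ℝ ∞ (J h i) S := by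
  induction i with
  | zero => exact t.smooth_zero h hh
  | succ i ih =>
    exact ((t.smooth (i + 1)).clm_apply ((U i).contDiff.comp_contDiffOn
      (hS.contDiffOn_fderivWithin_comp_tangentProj' ih))).congr fun x hx =>
        t.jet_succ h i x _ (ih.hasFDerivWithinAt_infty hx)

/-- The flat derivative of `∇^i h` in a tangent direction `w` is `∇_w ∇^i h` plus a term of order
zero in `∇^i h`, coming from the derivative of the projection to the tangential tensors. -/
theorem fderivWithin_jet (t : CovariantTower S E Q U K J) (hS : IsClosedSurface S) {h : Eu s → X}
    (hh : ContDiffOn ℝ ∞ h S) (i : ℕ) {x : Eu s} (hx : x ∈ S) {w : Eu s}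
    (hw : w ∈ tangentPlane S x) :
    fderivWithin ℝ (J h i) S x w = K i (J h (i + 1) x) w +
      ((fderivWithin ℝ (Q i) S x).comp (tangentProj S x)) w (J h i x) := by
  have hT' := (t.contDiffOn_jet hS hh i).hasFDerivWithinAt_infty hx
  have h1 := ((t.smooth i).hasFDerivWithinAt_infty hx).clm_apply hT'
  have h2 : HasFDerivWithinAt (J h i) _ S x :=
    h1.congr (fun y _ => (t.proj_jet h i y).symm) (t.proj_jet h i x).symm
  rw [t.jet_succ h i x _ hT', t.curry_uncurry i x hx _ w hw]
  refine (h2.fderivWithin_apply_of_mem hw).trans ?_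
  simp only [add_apply, ContinuousLinearMap.comp_apply,
    ContinuousLinearMap.flip_apply, tangentProj_of_mem hw]

variable {n : ℕ} {G : Set (Eu n)} {φ : Eu n → Eu s → Eu s}

/-- `∇^i (h ∘ φ_g)` at `x` is a combination of the `∇^j h`, `j ≤ i`, at `φ_g x`, with coefficients
smooth in `(g, x)` that do not depend on `h`. -/
theorem exists_jet_comp (t : CovariantTower S E Q U K J) (hS : IsClosedSurface S)
    (hφ : ContDiffOn ℝ ∞ (fun z : Eu n × Eu s => φ z.1 z.2) (G ×ˢ S))
    (hmap : ∀ g ∈ G, MapsTo (φ g) S S) (i : ℕ) :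
    ∃ C : (j : ℕ) → Eu n → Eu s → E j →L[ℝ] E i,
      (∀ j, ContDiffOn ℝ ∞ (fun z : Eu n × Eu s => C j z.1 z.2) (G ×ˢ S)) ∧
      ∀ g ∈ G, ∀ h : Eu s → X, ContDiffOn ℝ ∞ h S → ∀ x ∈ S,
        J (h ∘ φ g) i x = ∑ j ∈ Finset.range (i + 1), C j g x (J h j (φ g x)) := by
  induction i with
  | zero =>
    refine ⟨fun j _ _ => if hj : j = 0 then hj ▸ ContinuousLinearMap.id ℝ _ else 0,
      fun j => contDiffOn_const, fun g _ h _ x _ => ?_⟩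
    simp only [zero_add, Finset.range_one, Finset.sum_singleton]
    exact t.comp_zero h (φ g) x
  | succ i ih =>
    obtain ⟨C, hC, hCh⟩ := ih
    have hφS : MapsTo (fun z : Eu n × Eu s => φ z.1 z.2) (G ×ˢ S) S := fun z hz =>
      hmap z.1 hz.1 hz.2
    let R : (j : ℕ) → Eu s → Eu s →L[ℝ] E j →L[ℝ] E j := fun j x =>
      (fderivWithin ℝ (Q j) S x).comp (tangentProj S x)
    have hR : ∀ j, ContDiffOn ℝ ∞ (R j) S := fun j =>
      hS.contDiffOn_fderivWithin_comp_tangentProj' (t.smooth j)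
    let L : Eu n → Eu s → Eu s →L[ℝ] Eu s := fun g x =>
      (fderivWithin ℝ (φ g) S x).comp (tangentProj S x)
    let D : (j : ℕ) → Eu n → Eu s → Eu s →L[ℝ] E j →L[ℝ] E i := fun j g x =>
      (fderivWithin ℝ (C j g) S x).comp (tangentProj S x)
    let H : (j : ℕ) → Eu n → Eu s → Eu s →L[ℝ] E j →L[ℝ] E i := fun j g x =>
      (ContinuousLinearMap.compL ℝ _ _ _ (C j g x)).comp ((R j (φ g x)).comp (L g x))
    let W : Eu s → (Eu s →L[ℝ] E i) →L[ℝ] E (i + 1) := fun x => (Q (i + 1) x).comp (U i)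
    let A : (j : ℕ) → Eu n → Eu s → E j →L[ℝ] E (i + 1) := fun j g x =>
      (W x).comp (ContinuousLinearMap.flipₗᵢ ℝ _ _ _ (D j g x + H j g x))
    let B : (j : ℕ) → Eu n → Eu s → E (j + 1) →L[ℝ] E (i + 1) := fun j g x =>
      (W x).comp (((ContinuousLinearMap.compL ℝ (Eu s) (Eu s) (E i)).flip (L g x)).comp
        ((ContinuousLinearMap.compL ℝ (Eu s) (E j) (E i) (C j g x)).comp (K j)))
    have hL : ContDiffOn ℝ ∞ (fun z : Eu n × Eu s => L z.1 z.2) (G ×ˢ S) :=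
      hS.contDiffOn_fderivWithin_comp_tangentProj hφ
    have hD : ∀ j, ContDiffOn ℝ ∞ (fun z : Eu n × Eu s => D j z.1 z.2) (G ×ˢ S) := fun j =>
      hS.contDiffOn_fderivWithin_comp_tangentProj (hC j)
    have hH : ∀ j, ContDiffOn ℝ ∞ (fun z : Eu n × Eu s => H j z.1 z.2) (G ×ˢ S) := fun j =>
      ((ContinuousLinearMap.contDiff _).comp_contDiffOn (hC j)).clm_comp
        (((hR j).comp hφ hφS).clm_comp hL)
    have hW : ContDiffOn ℝ ∞ (fun z : Eu n × Eu s => W z.2) (G ×ˢ S) :=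
      ((t.smooth (i + 1)).comp contDiffOn_snd fun z hz => hz.2).clm_comp contDiffOn_const
    have hA : ∀ j, ContDiffOn ℝ ∞ (fun z : Eu n × Eu s => A j z.1 z.2) (G ×ˢ S) := fun j =>
      hW.clm_comp ((LinearIsometryEquiv.contDiff _).comp_contDiffOn ((hD j).add (hH j)))
    have hB : ∀ j, ContDiffOn ℝ ∞ (fun z : Eu n × Eu s => B j z.1 z.2) (G ×ˢ S) := fun j =>
      hW.clm_comp (((ContinuousLinearMap.contDiff _).comp_contDiffOn hL).clm_comp
        (((ContinuousLinearMap.contDiff _).comp_contDiffOn (hC j)).clm_comp contDiffOn_const))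
    let B' : (j : ℕ) → Eu n → Eu s → E j →L[ℝ] E (i + 1) := fun j =>
      match j with
      | 0 => fun _ _ => 0
      | j + 1 => B j
    refine ⟨fun j g x => (if j ≤ i then A j g x else 0) + B' j g x, fun j => ?_,
      fun g hg h hh x hx => ?_⟩
    · refine ContDiffOn.add ?_ ?_
      · by_cases hj : j ≤ i
        · simpa only [hj, if_true] using hA j
        · simpa only [hj, if_false] using contDiffOn_const
      · cases j with
        | zero => exact contDiffOn_const
        | succ j => exact hB j
    · have hφx := (contDiffOn_slice hφ hg).hasFDerivWithinAt_infty hx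
      have hsum : HasFDerivWithinAt (J (h ∘ φ g) i) _ S x :=
        (HasFDerivWithinAt.fun_sum (u := Finset.range (i + 1)) fun j _ =>
          ((contDiffOn_slice (hC j) hg).hasFDerivWithinAt_infty hx).clm_apply
            (((t.contDiffOn_jet hS hh j).hasFDerivWithinAt_infty (hmap g hg hx)).comp x hφx
              (hmap g hg))).congr
          (fun y hy => hCh g hg h hh y hy) (hCh g hg h hh x hx)
      have hcov : J (h ∘ φ g) (i + 1) x = ∑ j ∈ Finset.range (i + 1),
          (A j g x (J h j (φ g x)) + B j g x (J h (j + 1) (φ g x))) := by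
        rw [t.jet_succ _ _ _ _ hsum]
        have hsplit : (∑ j ∈ Finset.range (i + 1),
            (A j g x (J h j (φ g x)) + B j g x (J h (j + 1) (φ g x)))) =
            W x (∑ j ∈ Finset.range (i + 1), ((D j g x + H j g x).flip (J h j (φ g x)) +
              ((C j g x).comp (K j (J h (j + 1) (φ g x)))).comp (L g x))) := by
          rw [map_sum]
          refine Finset.sum_congr rfl fun j _ => ?_
          rw [map_add]
          rfl
        rw [hsplit]
        change W x _ = _
        congr 1
        ext1 v
        simp only [ContinuousLinearMap.comp_apply, sum_apply,
          add_apply, ContinuousLinearMap.flip_apply]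
        refine Finset.sum_congr rfl fun j _ => ?_
        rw [t.fderivWithin_jet hS hh j (hmap g hg hx)
          (hφx.map_tangentPlane (hmap g hg) (tangentProj_mem S x v)), map_add]
        change _ + _ + D j g x v _ = D j g x v _ +
          (C j g x) (R j (φ g x) (L g x v) (J h j (φ g x))) + (C j g x) _
        rw [add_comm, add_comm (C j g x _), add_assoc]
        rfl
      rw [hcov]
      simp only [add_apply, Finset.sum_add_distrib]
      congr 1
      · rw [Finset.sum_range_succ _ (i + 1)]
        simp only [add_le_iff_nonpos_right, nonpos_iff_eq_zero, one_ne_zero, if_false,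
          zero_apply, add_zero]
        refine Finset.sum_congr rfl fun j hj => ?_
        rw [if_pos (Nat.lt_succ_iff.1 (Finset.mem_range.1 hj))]
      · rw [Finset.sum_range_succ' _ (i + 1)]
        simp only [B', zero_apply, add_zero]

end CovariantTower

/-- `ℝ^M`-valued covariant `i`-tensors on `ℝ^s`. -/
abbrev Tens (s M i : ℕ) : Type := Eu s [×i]→L[ℝ] Eu M

/-- Pullback of `i`-tensors along a linear map, `T ↦ T (A ·, …, A ·)`. -/
noncomputable def tensPull (s M i : ℕ) (A : Eu s →L[ℝ] Eu s) : Tens s M i →L[ℝ] Tens s M i :=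
  ContinuousMultilinearMap.compContinuousLinearMapContinuousMultilinear ℝ
    (fun _ : Fin i => Eu s) (fun _ => Eu s) (Eu M) (fun _ => A)

theorem contDiff_tensPull (s M i : ℕ) : ContDiff ℝ ∞ (tensPull s M i) :=
  (ContinuousMultilinearMap.contDiff _).comp (contDiff_pi.2 fun _ => contDiff_id)

/-- Uncurrying `ℝ^s → (i-tensors)` to `(i+1)`-tensors, as a continuous linear map. -/
noncomputable def tensUncurry (s M i : ℕ) : (Eu s →L[ℝ] Tens s M i) →L[ℝ] Tens s M (i + 1) :=
  ((continuousMultilinearCurryLeftEquiv ℝ (fun _ : Fin (i + 1) => Eu s)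
    (Eu M)).symm.toContinuousLinearEquiv : _ →L[ℝ] _)

/-- Currying `(i+1)`-tensors to `ℝ^s → (i-tensors)`, as a continuous linear map. -/
noncomputable def tensCurry (s M i : ℕ) : Tens s M (i + 1) →L[ℝ] (Eu s →L[ℝ] Tens s M i) :=
  ((continuousMultilinearCurryLeftEquiv ℝ (fun _ : Fin (i + 1) => Eu s)
    (Eu M)).toContinuousLinearEquiv : _ →L[ℝ] _)

theorem covariantTower_iterCovDeriv {s : ℕ} {S : Set (Eu s)} (hS : IsClosedSurface S) (M : ℕ) :
    CovariantTower S (Tens s M) (fun i x => tensPull s M i (tangentProj S x))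
      (tensUncurry s M) (tensCurry s M) (iterCovDeriv S) where
  smooth i := (contDiff_tensPull s M i).comp_contDiffOn hS.contDiffOn_tangentProj
  curry_uncurry i x _ T' w hw := by
    ext1 v
    change T' (tangentProj S x (tangentProj S x w)) _ = T' w _
    rw [tangentProj_of_mem hw, tangentProj_of_mem hw]
    rfl
  jet_succ h i x T' hT' := by
    ext1 v
    change fderivWithin ℝ (iterCovDeriv S h i) S x (tangentProj S x (v 0)) _ =
      T' (tangentProj S x (tangentProj S x (v 0))) _
    rw [hT'.fderivWithin_apply_of_mem (tangentProj_mem S x _),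
      tangentProj_of_mem (tangentProj_mem S x _)]
  proj_jet h i x := by
    cases i with
    | zero => ext1 v; rfl
    | succ i =>
      ext1 v
      change ContinuousLinearMap.uncurryLeft (fderivWithin ℝ (iterCovDeriv S h i) S x)
        (fun a => tangentProj S x (tangentProj S x (v a))) =
          ContinuousLinearMap.uncurryLeft (fderivWithin ℝ (iterCovDeriv S h i) S x)
            (fun a => tangentProj S x (v a))
      simp only [tangentProj_of_mem (tangentProj_mem S x _)]
  smooth_zero h hh :=
    (continuousMultilinearCurryFin0 ℝ (Eu s) (Eu M)).symm.contDiff.comp_contDiffOn hh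
  comp_zero h θ x := rfl

/-! ### Smooth dependence of the inverse diffeomorphisms on the parameter -/

namespace IsDiffeoOf

variable {s : ℕ} {S : Set (Eu s)} {θ : Eu s → Eu s}

theorem injOn (h : IsDiffeoOf S θ) : InjOn θ S := by
  obtain ⟨η, -, -, hη⟩ := h.exists_inv
  exact hη.1.injOn

theorem surjOn (h : IsDiffeoOf S θ) : SurjOn θ S S := by
  obtain ⟨η, -, hm, hη⟩ := h.exists_inv
  exact hη.2.surjOn hm

theorem mapsTo_invFunOn (h : IsDiffeoOf S θ) : MapsTo (Function.invFunOn θ S) S S := fun _ hy =>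
  Function.invFunOn_mem (h.surjOn hy)

theorem apply_invFunOn (h : IsDiffeoOf S θ) {y : Eu s} (hy : y ∈ S) :
    θ (Function.invFunOn θ S y) = y :=
  Function.invFunOn_eq (h.surjOn hy)

theorem invFunOn_apply (h : IsDiffeoOf S θ) {x : Eu s} (hx : x ∈ S) :
    Function.invFunOn θ S (θ x) = x :=
  h.injOn.leftInvOn_invFunOn hx

theorem symm (h : IsDiffeoOf S θ) : IsDiffeoOf S (Function.invFunOn θ S) where
  smooth := by
    obtain ⟨η, hs, hm, hη⟩ := h.exists_inv
    refine hs.congr fun y hy => h.injOn (h.mapsTo_invFunOn hy) (hm hy) ?_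
    rw [h.apply_invFunOn hy, hη.2 hy]
  mapsTo := h.mapsTo_invFunOn
  exists_inv := ⟨θ, h.smooth, h.mapsTo, fun _ hy => h.apply_invFunOn hy,
    fun _ hx => h.invFunOn_apply hx⟩

end IsDiffeoOf

section

variable {s n : ℕ} {S : Set (Eu s)} {G : Set (Eu n)} {φ : Eu n → Eu s → Eu s}

/-- The inverse function theorem, applied in charts to `(g, x) ↦ (g, φ_g x)`. -/
theorem IsClosedSurface.contDiffOn_invFunOn (hS : IsClosedSurface S) (hG : IsOpen G)
    (hφ : ContDiffOn ℝ ∞ (fun z : Eu n × Eu s => φ z.1 z.2) (G ×ˢ S))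
    (hdiff : ∀ g ∈ G, IsDiffeoOf S (φ g)) :
    ContDiffOn ℝ ∞ (fun z : Eu n × Eu s => Function.invFunOn (φ z.1) S z.2) (G ×ˢ S) := by
  rintro ⟨g₀, y₀⟩ ⟨hg₀ : g₀ ∈ G, hy₀ : y₀ ∈ S⟩
  have hn : (∞ : ℕ∞ω) ≠ 0 := by simp
  have hd₀ := hdiff g₀ hg₀
  obtain ⟨V, ψ, h, a₀, ha₀, hx₀⟩ := hS.exists_param _ (hd₀.mapsTo_invFunOn hy₀)
  obtain ⟨V', ψ', h', b₀, hb₀, rfl⟩ := hS.exists_param y₀ hy₀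
  have hφ₀ : φ g₀ (ψ a₀) = ψ' b₀ := by rw [hx₀, hd₀.apply_invFunOn hy₀]
  let Ψ : Eu n × Eu 2 → Eu s := fun z => φ z.1 (ψ z.2)
  have hGV : G ×ˢ V ∈ 𝓝 (g₀, a₀) := prod_mem_nhds (hG.mem_nhds hg₀) (h.isOpen.mem_nhds ha₀)
  have hΨS : MapsTo Ψ (G ×ˢ V) S := fun z hz => (hdiff z.1 hz.1).mapsTo (h.mapsTo hz.2)
  have hΨ : ContDiffOn ℝ ∞ Ψ (G ×ˢ V) :=
    hφ.comp (contDiffOn_fst.prodMk (h.smooth.comp contDiffOn_snd fun z hz => hz.2))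
      fun z hz => ⟨hz.1, h.mapsTo hz.2⟩
  have hmem₀ : (g₀, a₀) ∈ G ×ˢ V := ⟨hg₀, ha₀⟩
  have hχ' : ContDiffWithinAt ℝ ∞ (Function.invFunOn ψ' V') S (Ψ (g₀, a₀)) := by
    change ContDiffWithinAt ℝ ∞ (Function.invFunOn ψ' V') S (φ g₀ (ψ a₀))
    rw [hφ₀]; exact h'.contDiffWithinAt_invFunOn hb₀
  have hκ : ContDiffAt ℝ ∞ (fun z => Function.invFunOn ψ' V' (Ψ z)) (g₀, a₀) :=
    (hχ'.comp (g₀, a₀) (hΨ _ hmem₀) hΨS).contDiffAt hGV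
  let H : Eu n × Eu 2 → Eu n × Eu 2 := fun z => (z.1, Function.invFunOn ψ' V' (Ψ z))
  have hH : ContDiffAt ℝ ∞ H (g₀, a₀) := contDiffAt_fst.prodMk hκ
  have hκ' := (hκ.differentiableAt hn).hasFDerivAt
  have hH₀ : H (g₀, a₀) = (g₀, b₀) := by
    change (g₀, Function.invFunOn ψ' V' (φ g₀ (ψ a₀))) = _
    rw [hφ₀, h'.invFunOn_apply hb₀]
  -- the derivative in `a` is injective, because `φ g₀` has a smooth inverse
  have hinj2 : ∀ v : Eu 2, fderiv ℝ (fun z => Function.invFunOn ψ' V' (Ψ z)) (g₀, a₀) (0, v) = 0 →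
      v = 0 := by
    have h1 : HasFDerivAt (fun a => Function.invFunOn ψ' V' (Ψ (g₀, a)))
        ((fderiv ℝ (fun z => Function.invFunOn ψ' V' (Ψ z)) (g₀, a₀)).comp
          (ContinuousLinearMap.inr ℝ (Eu n) (Eu 2))) a₀ :=
      HasFDerivAt.comp (f := fun a => (g₀, a)) a₀ hκ' (hasFDerivAt_prodMk_right g₀ a₀)
    have h2 : ContDiffWithinAt ℝ ∞ (fun b => Function.invFunOn (φ g₀) S (ψ' b)) V' b₀ :=
      (hd₀.symm.smooth _ hy₀).comp b₀ (h'.smooth b₀ hb₀) h'.mapsTo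
    have h3 : ContDiffWithinAt ℝ ∞ (Function.invFunOn ψ V) S
        (Function.invFunOn (φ g₀) S (ψ' b₀)) := by
      rw [← hx₀]; exact h.contDiffWithinAt_invFunOn ha₀
    have h4 := ((h3.comp b₀ h2 fun b hb => hd₀.mapsTo_invFunOn (h'.mapsTo hb)).contDiffAt
      (h'.isOpen.mem_nhds hb₀)).differentiableAt hn
    have h5 := h4.hasFDerivAt
    have hb₀e : Function.invFunOn ψ' V' (Ψ (g₀, a₀)) = b₀ := congrArg Prod.snd hH₀
    have h6 : HasFDerivAt _ _ a₀ := HasFDerivAt.comp a₀ (hb₀e.symm ▸ h5) h1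
    have hcont : Tendsto (fun a => Ψ (g₀, a)) (𝓝 a₀) (𝓝[S] (ψ' b₀)) := by
      refine tendsto_nhdsWithin_iff.2 ⟨?_, ?_⟩
      · have : ContinuousAt (fun a => Ψ (g₀, a)) a₀ :=
          ContinuousAt.comp (f := fun a => (g₀, a)) ((hΨ.contDiffAt hGV).continuousAt)
            (by fun_prop)
        have h7 := this.tendsto
        rwa [show Ψ (g₀, a₀) = ψ' b₀ from hφ₀] at h7
      · filter_upwards [h.isOpen.mem_nhds ha₀] with a ha
        exact hΨS ⟨hg₀, ha⟩
    have h7 : HasFDerivAt (fun a : Eu 2 => a) _ a₀ := h6.congr_of_eventuallyEq (by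
      filter_upwards [hcont.eventually (h'.eventually_apply_invFunOn hb₀), h.isOpen.mem_nhds ha₀]
        with a ha haV
      simp only [Function.comp_apply]
      rw [ha.2]
      change a = Function.invFunOn ψ V (Function.invFunOn (φ g₀) S (φ g₀ (ψ a)))
      rw [hd₀.invFunOn_apply (h.mapsTo haV), h.invFunOn_apply haV])
    have h8 := h7.unique (hasFDerivAt_id a₀)
    intro v hv
    have h9 := DFunLike.congr_fun h8 v
    rw [ContinuousLinearMap.comp_apply, ContinuousLinearMap.comp_apply,
      ContinuousLinearMap.inr_apply, hv, map_zero] at h9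
    exact h9.symm
  have hH'0 := (hasFDerivAt_fst (𝕜 := ℝ) (p := ((g₀, a₀) : Eu n × Eu 2))).prodMk hκ'
  have hinj : Function.Injective
      ((ContinuousLinearMap.fst ℝ (Eu n) (Eu 2)).prod
        (fderiv ℝ (fun z => Function.invFunOn ψ' V' (Ψ z)) (g₀, a₀))).toLinearMap := by
    rw [← LinearMap.ker_eq_bot, LinearMap.ker_eq_bot']
    rintro ⟨w, v⟩ hwv
    have hw : w = 0 := congrArg Prod.fst hwv
    subst hw
    have hv := hinj2 v (congrArg Prod.snd hwv)
    rw [hv]; rfl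
  let e : (Eu n × Eu 2) ≃L[ℝ] (Eu n × Eu 2) :=
    (LinearEquiv.ofInjectiveEndo _ hinj).toContinuousLinearEquiv
  have hH' : HasFDerivAt H (e : Eu n × Eu 2 →L[ℝ] Eu n × Eu 2) (g₀, a₀) := hH'0
  let Hi := hH.localInverse hH' hn
  have hHi : ContDiffAt ℝ ∞ Hi (H (g₀, a₀)) := hH.to_localInverse hH' hn
  have hright : ∀ᶠ y in 𝓝 (H (g₀, a₀)), H (Hi y) = y :=
    (hH.hasStrictFDerivAt' hH' hn).eventually_right_inverse
  have hHi₀ : Hi (H (g₀, a₀)) = (g₀, a₀) := hH.localInverse_apply_image hH' hn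
  rw [hH₀] at hHi hright hHi₀
  let m : Eu n × Eu s → Eu n × Eu 2 := fun z => (z.1, Function.invFunOn ψ' V' z.2)
  have hm : ContDiffWithinAt ℝ ∞ m (G ×ˢ S) (g₀, ψ' b₀) :=
    contDiffWithinAt_fst.prodMk ((h'.contDiffWithinAt_invFunOn hb₀).comp (g₀, ψ' b₀)
      contDiffWithinAt_snd fun z hz => hz.2)
  have hm₀ : m (g₀, ψ' b₀) = (g₀, b₀) := by simp only [m, h'.invFunOn_apply hb₀]
  have hHm : ContDiffWithinAt ℝ ∞ (fun z => Hi (m z)) (G ×ˢ S) (g₀, ψ' b₀) :=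
    ContDiffAt.comp_contDiffWithinAt (g := Hi) _ (by rw [hm₀]; exact hHi) hm
  have hHm₀ : Hi (m (g₀, ψ' b₀)) = (g₀, a₀) := by rw [hm₀, hHi₀]
  have hfin : ContDiffWithinAt ℝ ∞ (fun z => ψ (Hi (m z)).2) (G ×ˢ S) (g₀, ψ' b₀) :=
    ContDiffAt.comp_contDiffWithinAt (g := ψ) _ (by rw [hHm₀]; exact h.contDiffAt ha₀) hHm.snd
  refine hfin.congr_of_eventuallyEq_of_mem ?_ ⟨hg₀, hy₀⟩
  have ht1 : Tendsto m (𝓝[G ×ˢ S] (g₀, ψ' b₀)) (𝓝 (g₀, b₀)) := by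
    rw [← hm₀]; exact hm.continuousWithinAt
  have ht2 : Tendsto (fun z => Hi (m z)) (𝓝[G ×ˢ S] (g₀, ψ' b₀)) (𝓝 (g₀, a₀)) := by
    rw [← hHm₀]; exact hHm.continuousWithinAt
  have ht3 : Tendsto Prod.snd (𝓝[G ×ˢ S] (g₀, ψ' b₀)) (𝓝[S] (ψ' b₀)) :=
    tendsto_nhdsWithin_iff.2 ⟨(continuous_snd.tendsto (g₀, ψ' b₀)).mono_left nhdsWithin_le_nhds,
      by filter_upwards [self_mem_nhdsWithin] with z hz using hz.2⟩
  have ht4 : Tendsto Ψ (𝓝 (g₀, a₀)) (𝓝[S] (ψ' b₀)) :=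
    tendsto_nhdsWithin_iff.2 ⟨hφ₀ ▸ (hΨ.contDiffAt hGV).continuousAt.tendsto,
      mem_of_superset hGV fun z hz => hΨS hz⟩
  filter_upwards [self_mem_nhdsWithin, ht1.eventually hright, ht2.eventually hGV,
    ht3.eventually (h'.eventually_apply_invFunOn hb₀),
    (ht4.comp ht2).eventually (h'.eventually_apply_invFunOn hb₀)] with z hz h1 h2 h3 h4
  have h5 : (Hi (m z)).1 = z.1 := congrArg Prod.fst h1
  have h6 : Function.invFunOn ψ' V' (Ψ (Hi (m z))) = Function.invFunOn ψ' V' z.2 :=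
    congrArg Prod.snd h1
  have h7 : Ψ (Hi (m z)) = z.2 := by rw [← h3.2, ← h6]; exact h4.2.symm
  have h8 : φ z.1 (ψ (Hi (m z)).2) = z.2 := by rw [← h7, ← h5]
  rw [← h8, (hdiff z.1 hz.1).invFunOn_apply (h.mapsTo h2.2)]

end

/-! ### The area measure in a parametrization -/

/-- The area distortion `√det (BᵀB)` of a linear map `B : ℝ² → ℝ^s`. -/
noncomputable def gramDensity {s : ℕ} (B : Eu 2 →L[ℝ] Eu s) : ℝ :=
  Real.sqrt (Matrix.det (Matrix.gram ℝ fun a : Fin 2 => B (EuclideanSpace.single a 1)))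

section gramDensity

variable {s : ℕ}

theorem areaDensity_eq (ψ : Eu 2 → Eu s) (y : Eu 2) :
    areaDensity ψ y = ENNReal.ofReal (gramDensity (fderiv ℝ ψ y)) := rfl

theorem eu2_eq (v : Eu 2) :
    v = v 0 • EuclideanSpace.single 0 (1 : ℝ) + v 1 • EuclideanSpace.single 1 1 := by
  ext i
  fin_cases i <;> simp

theorem det_gram_comp (B : Eu 2 →L[ℝ] Eu s) (τ : Eu 2 →L[ℝ] Eu 2) :
    Matrix.det (Matrix.gram ℝ fun a : Fin 2 => (B.comp τ) (EuclideanSpace.single a 1)) =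
      Matrix.det (Matrix.gram ℝ fun a : Fin 2 => B (EuclideanSpace.single a 1)) * τ.det ^ 2 := by
  have hdet : τ.det = (τ (EuclideanSpace.single 0 1)) 0 * (τ (EuclideanSpace.single 1 1)) 1 -
      (τ (EuclideanSpace.single 1 1)) 0 * (τ (EuclideanSpace.single 0 1)) 1 := by
    rw [ContinuousLinearMap.det, 
      ← LinearMap.det_toMatrix (EuclideanSpace.basisFun (Fin 2) ℝ).toBasis, Matrix.det_fin_two]
    simp [LinearMap.toMatrix_apply]
  have h : ∀ a : Fin 2, (B.comp τ) (EuclideanSpace.single a 1) =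
      (τ (EuclideanSpace.single a 1)) 0 • B (EuclideanSpace.single 0 1) +
        (τ (EuclideanSpace.single a 1)) 1 • B (EuclideanSpace.single 1 1) := fun a => by
    rw [ContinuousLinearMap.comp_apply]
    conv_lhs => rw [eu2_eq (τ (EuclideanSpace.single a 1))]
    rw [map_add, map_smul, map_smul]
  simp only [h]
  rw [hdet, Matrix.det_fin_two, Matrix.det_fin_two]
  simp only [Matrix.gram_apply, inner_add_left, inner_add_right, real_inner_smul_left,
    real_inner_smul_right]
  rw [real_inner_comm (B (EuclideanSpace.single 0 1)) (B (EuclideanSpace.single 1 1))]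
  ring

theorem gramDensity_comp (B : Eu 2 →L[ℝ] Eu s) (τ : Eu 2 →L[ℝ] Eu 2) :
    gramDensity (B.comp τ) = gramDensity B * |τ.det| := by
  rw [gramDensity, det_gram_comp, Real.sqrt_mul' _ (sq_nonneg _), Real.sqrt_sq_eq_abs]
  rfl

theorem det_gram_pos {B : Eu 2 →L[ℝ] Eu s} (hB : Function.Injective B) :
    0 < Matrix.det (Matrix.gram ℝ fun a : Fin 2 => B (EuclideanSpace.single a 1)) := by
  apply Matrix.PosDef.det_pos
  apply Matrix.posDef_gram_of_linearIndependent
  have h1 := (EuclideanSpace.basisFun (Fin 2) ℝ).toBasis.linearIndependent.map'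
    B.toLinearMap (LinearMap.ker_eq_bot.2 hB)
  have h2 : (fun a : Fin 2 => B (EuclideanSpace.single a 1)) =
      B.toLinearMap ∘ (EuclideanSpace.basisFun (Fin 2) ℝ).toBasis := by
    ext a : 1
    simp
  rw [h2]
  exact h1

theorem gramDensity_nonneg (B : Eu 2 →L[ℝ] Eu s) : 0 ≤ gramDensity B := Real.sqrt_nonneg _

theorem gramDensity_pos {B : Eu 2 →L[ℝ] Eu s} (hB : Function.Injective B) : 0 < gramDensity B :=
  Real.sqrt_pos.2 (det_gram_pos hB)

theorem contDiff_det_gram : ContDiff ℝ ∞ fun B : Eu 2 →L[ℝ] Eu s =>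
    Matrix.det (Matrix.gram ℝ fun a : Fin 2 => B (EuclideanSpace.single a 1)) := by
  simp only [Matrix.det_fin_two, Matrix.gram_apply]
  have h : ∀ a : Fin 2, ContDiff ℝ ∞ fun B : Eu 2 →L[ℝ] Eu s => B (EuclideanSpace.single a 1) :=
    fun a => contDiff_id.clm_apply contDiff_const
  exact (((h 0).inner ℝ (h 0)).mul ((h 1).inner ℝ (h 1))).sub
    (((h 0).inner ℝ (h 1)).mul ((h 1).inner ℝ (h 0)))

theorem continuous_gramDensity : Continuous (gramDensity (s := s)) :=
  Real.continuous_sqrt.comp contDiff_det_gram.continuous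

theorem contDiffAt_gramDensity {B : Eu 2 →L[ℝ] Eu s} (hB : Function.Injective B) :
    ContDiffAt ℝ ∞ gramDensity B :=
  contDiff_det_gram.contDiffAt.sqrt (det_gram_pos hB).ne'

/-- Two frames of the same plane differ by an automorphism of `ℝ²`. -/
theorem exists_comp_of_range_eq {B C : Eu 2 →L[ℝ] Eu s} (hC : Function.Injective C)
    (h : LinearMap.range B.toLinearMap = LinearMap.range C.toLinearMap) :
    ∃ τ : Eu 2 →L[ℝ] Eu 2, C = B.comp τ ∧ τ.det ≠ 0 := by
  have h1 : ∀ v, ∃ w, B w = C v := fun v => by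
    have : C v ∈ LinearMap.range B.toLinearMap := h ▸ ⟨v, rfl⟩
    exact this
  obtain ⟨t, ht⟩ := LinearMap.exists_rightInverse_of_surjective B.toLinearMap.rangeRestrict
    (LinearMap.range_rangeRestrict _)
  let τ : Eu 2 →L[ℝ] Eu 2 := LinearMap.toContinuousLinearMap
    (t.comp (C.toLinearMap.codRestrict _ fun v => h1 v))
  have hτ : C = B.comp τ := by
    ext1 v
    exact (congrArg Subtype.val (LinearMap.congr_fun ht ⟨C v, h1 v⟩)).symm
  refine ⟨τ, hτ, fun h0 => ?_⟩
  have hinj : Function.Injective τ := fun a b hab => hC (by rw [hτ]; simp [hab])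
  have := LinearMap.isUnit_det τ.toLinearMap
    ((Module.End.isUnit_iff _).2 ⟨hinj, (LinearMap.injective_iff_surjective
      (f := τ.toLinearMap)).1 hinj⟩)
  exact this.ne_zero h0

end gramDensity

/-- The measure `ψ_* (√det(g_ab) dy)` of a parametrization. -/
noncomputable abbrev paramMeasure {s : ℕ} (V : Set (Eu 2)) (ψ : Eu 2 → Eu s) : Measure (Eu s) :=
  ((volume.restrict V).withDensity (areaDensity ψ)).map ψ

namespace IsLocalParam

variable {s : ℕ} {S : Set (Eu s)} {V V₁ : Set (Eu 2)} {ψ ψ₁ : Eu 2 → Eu s}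

theorem aemeasurable (h : IsLocalParam S V ψ) : AEMeasurable ψ (volume.restrict V) :=
  h.smooth.continuousOn.aemeasurable h.isOpen.measurableSet

theorem aemeasurable_areaDensity (h : IsLocalParam S V ψ) :
    AEMeasurable (areaDensity ψ) (volume.restrict V) := by
  refine ContinuousOn.aemeasurable ?_ h.isOpen.measurableSet
  exact (ENNReal.continuous_ofReal.comp continuous_gramDensity).comp_continuousOn
    (h.smooth.continuousOn_fderiv_of_isOpen h.isOpen (by simp))

theorem lintegral_paramMeasure (h : IsLocalParam S V ψ) {f : Eu s → ℝ≥0∞}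
    (hf : AEMeasurable f (paramMeasure V ψ)) :
    ∫⁻ x, f x ∂(paramMeasure V ψ) = ∫⁻ y in V, areaDensity ψ y * f (ψ y) := by
  have hψ : AEMeasurable ψ ((volume.restrict V).withDensity (areaDensity ψ)) :=
    h.aemeasurable.mono_ac (withDensity_absolutelyContinuous _ _)
  rw [lintegral_map' hf hψ]
  exact lintegral_withDensity_eq_lintegral_mul₀' h.aemeasurable_areaDensity
    (hf.comp_aemeasurable hψ)

theorem measurableSet_inter_preimage (h : IsLocalParam S V ψ) {B : Set (Eu s)}
    (hB : MeasurableSet B) : MeasurableSet (V ∩ ψ ⁻¹' B) := by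
  classical
  have h1 : Measurable (V.piecewise ψ fun _ => 0) :=
    h.smooth.continuousOn.measurable_piecewise continuousOn_const h.isOpen.measurableSet
  have h2 : V ∩ ψ ⁻¹' B = V ∩ (V.piecewise ψ fun _ => 0) ⁻¹' B := by
    ext y
    simp only [mem_inter_iff, mem_preimage]
    exact and_congr_right fun hy => by rw [piecewise_eq_of_mem _ _ _ hy]
  rw [h2]
  exact h.isOpen.measurableSet.inter (h1 hB)

theorem paramMeasure_apply (h : IsLocalParam S V ψ) {B : Set (Eu s)} (hB : MeasurableSet B) :
    paramMeasure V ψ B = ∫⁻ y in V ∩ ψ ⁻¹' B, areaDensity ψ y := by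
  rw [← lintegral_indicator_one hB,
    h.lintegral_paramMeasure (measurable_one.indicator hB).aemeasurable]
  have hm := h.measurableSet_inter_preimage hB
  rw [← lintegral_indicator h.isOpen.measurableSet, ← lintegral_indicator hm]
  congr 1
  ext y
  by_cases hy : y ∈ V
  · by_cases hyB : ψ y ∈ B
    · rw [indicator_of_mem hy, indicator_of_mem hyB, indicator_of_mem (show y ∈ V ∩ ψ ⁻¹' B from
        ⟨hy, hyB⟩), Pi.one_apply, mul_one]
    · rw [indicator_of_mem hy, indicator_of_notMem hyB, indicator_of_notMem (fun h => hyB h.2),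
        mul_zero]
  · rw [indicator_of_notMem hy, indicator_of_notMem fun h => hy h.1]

theorem measurableSet_image (h : IsLocalParam S V ψ) (hS : IsClosedSurface S) :
    MeasurableSet (ψ '' V) := by
  obtain ⟨O, hO, hOe⟩ := h.open_image V subset_rfl h.isOpen
  rw [hOe]
  exact hS.isCompact.isClosed.measurableSet.inter hO.measurableSet

/-- Change of variables between two parametrizations. -/
theorem paramMeasure_le (h : IsLocalParam S V ψ) (h₁ : IsLocalParam S V₁ ψ₁) {B : Set (Eu s)}
    (hB : MeasurableSet B) (hBV : B ⊆ ψ '' V) : paramMeasure V₁ ψ₁ B ≤ paramMeasure V ψ B := by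
  rw [h.paramMeasure_apply hB, h₁.paramMeasure_apply hB]
  set D := V₁ ∩ ψ₁ ⁻¹' B
  let τ : Eu 2 → Eu 2 := fun y => Function.invFunOn ψ V (ψ₁ y)
  have hτV : ∀ y ∈ D, τ y ∈ V ∧ ψ (τ y) = ψ₁ y := fun y hy =>
    ⟨Function.invFunOn_mem (hBV hy.2), Function.invFunOn_eq (hBV hy.2)⟩
  have hτ' : ∀ y ∈ D, HasFDerivAt τ (fderiv ℝ τ y) y ∧
      fderiv ℝ ψ₁ y = (fderiv ℝ ψ (τ y)).comp (fderiv ℝ τ y) := by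
    intro y hy
    obtain ⟨a, ha, hay⟩ := hBV hy.2
    have h1 : ContDiffWithinAt ℝ ∞ (Function.invFunOn ψ V) S (ψ₁ y) := by
      rw [← hay]; exact h.contDiffWithinAt_invFunOn ha
    have h2 : ContDiffAt ℝ ∞ τ y :=
      (h1.comp y (h₁.smooth y hy.1) h₁.mapsTo).contDiffAt (h₁.isOpen.mem_nhds hy.1)
    have h3 := (h2.differentiableAt (by simp)).hasFDerivAt
    refine ⟨h3, ?_⟩
    have h4 := (h.hasFDerivAt (hτV y hy).1).comp y h3
    have ht : Tendsto ψ₁ (𝓝 y) (𝓝[S] (ψ a)) := tendsto_nhdsWithin_iff.2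
      ⟨hay ▸ (h₁.contDiffAt hy.1).continuousAt.tendsto,
        mem_of_superset (h₁.isOpen.mem_nhds hy.1) h₁.mapsTo⟩
    have h5 := h4.congr_of_eventuallyEq (f₁ := ψ₁)
      ((ht.eventually (h.eventually_apply_invFunOn ha)).mono fun z hz => hz.2.symm)
    exact h5.fderiv
  have hinj : InjOn τ D := fun y hy z hz hyz => h₁.injOn hy.1 hz.1 (by
    rw [← (hτV y hy).2, ← (hτV z hz).2, hyz])
  have hcv := lintegral_image_eq_lintegral_abs_det_fderiv_mul volume
    (h₁.measurableSet_inter_preimage hB) (fun y hy => (hτ' y hy).1.hasFDerivWithinAt) hinj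
    (areaDensity ψ)
  have h6 : ∫⁻ y in D, areaDensity ψ₁ y =
      ∫⁻ y in D, ENNReal.ofReal |(fderiv ℝ τ y).det| * areaDensity ψ (τ y) := by
    refine setLIntegral_congr_fun (h₁.measurableSet_inter_preimage hB) fun y hy => ?_
    simp only [areaDensity_eq]
    rw [(hτ' y hy).2, gramDensity_comp, ENNReal.ofReal_mul (gramDensity_nonneg _), mul_comm]
  rw [h6, ← hcv]
  refine lintegral_mono_set ?_
  rintro _ ⟨y, hy, rfl⟩
  exact ⟨(hτV y hy).1, by rw [mem_preimage, (hτV y hy).2]; exact hy.2⟩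

theorem paramMeasure_compl_image (h : IsLocalParam S V ψ) (hS : IsClosedSurface S) :
    paramMeasure V ψ (ψ '' V)ᶜ = 0 := by
  rw [h.paramMeasure_apply (h.measurableSet_image hS).compl]
  have : V ∩ ψ ⁻¹' (ψ '' V)ᶜ = ∅ := by
    ext y
    simp only [mem_inter_iff, mem_preimage, mem_compl_iff, mem_empty_iff_false, iff_false, not_and,
      not_not]
    exact fun hy => mem_image_of_mem _ hy
  rw [this, Measure.restrict_empty, lintegral_zero_measure]

/-- The area measure restricts to the measure of each parametrization: the measure that agrees with
`ψ_* (√det(g_ab) dy)` on the image of `ψ` and is infinite elsewhere dominates the measures of all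
parametrizations. -/
theorem areaMeasure_restrict_image (h : IsLocalParam S V ψ) (hS : IsClosedSurface S) :
    (areaMeasure S).restrict (ψ '' V) = paramMeasure V ψ := by
  have hI := h.measurableSet_image hS
  have hle : areaMeasure S ≤ paramMeasure V ψ + (⊤ : Measure (Eu s)).restrict (ψ '' V)ᶜ := by
    refine iSup_le fun c => Measure.le_iff.2 fun B hB => ?_
    change paramMeasure c.1.1 c.1.2 B ≤ _
    rw [← measure_inter_add_sdiff B hI, Measure.add_apply, Measure.restrict_apply hB]
    refine add_le_add ((h.paramMeasure_le c.2 (hB.inter hI) inter_subset_right).trans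
      (measure_mono inter_subset_left)) ?_
    exact Measure.le_iff'.1 le_top _
  apply le_antisymm
  · refine Measure.le_iff.2 fun B hB => ?_
    rw [Measure.restrict_apply hB]
    refine (Measure.le_iff'.1 hle _).trans ?_
    rw [Measure.add_apply, Measure.restrict_apply (hB.inter hI), inter_assoc, inter_compl_self,
      inter_empty, measure_empty, add_zero]
    exact measure_mono inter_subset_left
  · have h1 : paramMeasure V ψ ≤ areaMeasure S :=
      le_iSup (fun c : {c : Set (Eu 2) × (Eu 2 → Eu s) // IsLocalParam S c.1 c.2} =>
        paramMeasure c.1.1 c.1.2) ⟨(V, ψ), h⟩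
    rw [← Measure.restrict_eq_self_of_ae_mem (μ := paramMeasure V ψ) (s := ψ '' V)
      (mem_ae_iff.2 (h.paramMeasure_compl_image hS))]
    exact Measure.restrict_mono subset_rfl h1

end IsLocalParam

theorem IsClosedSurface.ae_mem {s : ℕ} {S : Set (Eu s)} (hS : IsClosedSurface S) :
    ∀ᵐ x ∂(areaMeasure S), x ∈ S := by
  have hm := hS.isCompact.isClosed.measurableSet
  have hle : areaMeasure S ≤ (⊤ : Measure (Eu s)).restrict S := by
    refine iSup_le fun c => ?_
    change paramMeasure c.1.1 c.1.2 ≤ _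
    have h1 : paramMeasure c.1.1 c.1.2 Sᶜ = 0 :=
      measure_mono_null (compl_subset_compl.2 c.2.image_subset) (c.2.paramMeasure_compl_image hS)
    rw [← Measure.restrict_eq_self_of_ae_mem (μ := paramMeasure c.1.1 c.1.2) (s := S)
      (mem_ae_iff.2 h1)]
    exact Measure.restrict_mono subset_rfl le_top
  have h2 := Measure.le_iff'.1 hle Sᶜ
  rw [Measure.restrict_apply hm.compl, compl_inter_self, measure_empty] at h2
  exact mem_ae_iff.2 (le_antisymm h2 zero_le)

theorem IsClosedSurface.areaMeasure_restrict_self {s : ℕ} {S : Set (Eu s)}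
    (hS : IsClosedSurface S) : (areaMeasure S).restrict S = areaMeasure S :=
  Measure.restrict_eq_self_of_ae_mem hS.ae_mem

theorem IsClosedSurface.aestronglyMeasurable {s : ℕ} {S : Set (Eu s)} (hS : IsClosedSurface S)
    {F : Type*} [TopologicalSpace F] [TopologicalSpace.PseudoMetrizableSpace F]
    {f : Eu s → F} (hf : ContinuousOn f S) : AEStronglyMeasurable f (areaMeasure S) := by
  rw [← hS.areaMeasure_restrict_self]
  exact hf.aestronglyMeasurable hS.isCompact.isClosed.measurableSet

/-! ### Change of variables under a diffeomorphism -/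

section

variable {s : ℕ} {S : Set (Eu s)} {θ : Eu s → Eu s}

theorem IsDiffeoOf.hasFDerivWithinAt (h : IsDiffeoOf S θ) {x : Eu s} (hx : x ∈ S) :
    HasFDerivWithinAt θ (fderivWithin ℝ θ S x) S x :=
  h.smooth.hasFDerivWithinAt_infty hx

theorem IsLocalParam.fderiv_comp {F : Type*} [NormedAddCommGroup F] [NormedSpace ℝ F]
    {V : Set (Eu 2)} {ψ : Eu 2 → Eu s} (h : IsLocalParam S V ψ)
    {f : Eu s → F} (hf : ContDiffOn ℝ ∞ f S) {a : Eu 2} (ha : a ∈ V) :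
    fderiv ℝ (f ∘ ψ) a = (fderivWithin ℝ f S (ψ a)).comp (fderiv ℝ ψ a) :=
  (((hf.hasFDerivWithinAt_infty (h.mapsTo ha)).comp a (h.hasFDerivAt ha).hasFDerivWithinAt
    h.mapsTo).hasFDerivAt (h.isOpen.mem_nhds ha)).fderiv

theorem IsLocalParam.comp_diffeo {V : Set (Eu 2)} {ψ : Eu 2 → Eu s} (h : IsLocalParam S V ψ)
    (hθ : IsDiffeoOf S θ) : IsLocalParam S V (θ ∘ ψ) where
  isOpen := h.isOpen
  smooth := hθ.smooth.comp h.smooth h.mapsTo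
  immersion a ha := by
    have hs : ContDiffOn ℝ ∞ (Function.invFunOn θ S ∘ θ) S :=
      hθ.symm.smooth.comp hθ.smooth hθ.mapsTo
    have h1 := h.fderiv_comp hs ha
    have h2 : Function.invFunOn θ S ∘ θ ∘ ψ =ᶠ[𝓝 a] ψ := by
      filter_upwards [h.isOpen.mem_nhds ha] with b hb
      exact hθ.invFunOn_apply (h.mapsTo hb)
    have h3 : ContDiffAt ℝ ∞ (θ ∘ ψ) a :=
      (hθ.smooth.comp h.smooth h.mapsTo).contDiffAt (h.isOpen.mem_nhds ha)
    have h4 := ((hθ.symm.hasFDerivWithinAt (hθ.mapsTo (h.mapsTo ha))).comp a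
      (h3.differentiableAt (by simp)).hasFDerivAt.hasFDerivWithinAt
      (hθ.mapsTo.comp h.mapsTo)).hasFDerivAt (h.isOpen.mem_nhds ha)
    have h5 := (h4.congr_of_eventuallyEq h2.symm).fderiv
    have h6 := h.immersion a ha
    rw [h5] at h6
    exact Function.Injective.of_comp h6
  injOn := hθ.injOn.comp h.injOn h.mapsTo
  open_image W hWV hW := by
    obtain ⟨O, hO, hOe⟩ := h.open_image W hWV hW
    obtain ⟨O', hO', hOe'⟩ := continuousOn_iff'.1 hθ.symm.smooth.continuousOn O hO
    refine ⟨O', hO', ?_⟩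
    rw [image_comp, hOe, inter_comm S O', ← hOe']
    ext y
    constructor
    · rintro ⟨x, ⟨hxS, hxO⟩, rfl⟩
      exact ⟨by rw [mem_preimage, hθ.invFunOn_apply hxS]; exact hxO, hθ.mapsTo hxS⟩
    · rintro ⟨hyO, hyS⟩
      exact ⟨_, ⟨hθ.mapsTo_invFunOn hyS, hyO⟩, hθ.apply_invFunOn hyS⟩

open Classical in
/-- A linear isomorphism of `ℝ²` with the tangent plane at `x`. -/
noncomputable def tangentFrame (S : Set (Eu s)) (x : Eu s) : Eu 2 →L[ℝ] Eu s :=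
  if h : ∃ B : Eu 2 →L[ℝ] Eu s, Function.Injective B ∧
    LinearMap.range B.toLinearMap = tangentPlane S x then h.choose else 0

/-- The area distortion of `θ` at `x`, in absolute value: `√det (BᵀLᵀLB) / √det (BᵀB)` for the
differential `L` of `θ` and any frame `B` of the tangent plane. -/
noncomputable def areaJacobian (S : Set (Eu s)) (θ : Eu s → Eu s) (x : Eu s) : ℝ :=
  gramDensity ((fderivWithin ℝ θ S x).comp (tangentFrame S x)) / gramDensity (tangentFrame S x)

theorem areaJacobian_nonneg (x : Eu s) : 0 ≤ areaJacobian S θ x :=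
  div_nonneg (gramDensity_nonneg _) (gramDensity_nonneg _)

theorem IsLocalParam.areaJacobian_eq {V : Set (Eu 2)} {ψ : Eu 2 → Eu s} (h : IsLocalParam S V ψ)
    {a : Eu 2} (ha : a ∈ V) :
    areaJacobian S θ (ψ a) =
      gramDensity ((fderivWithin ℝ θ S (ψ a)).comp (fderiv ℝ ψ a)) /
        gramDensity (fderiv ℝ ψ a) := by
  have hex : ∃ B : Eu 2 →L[ℝ] Eu s, Function.Injective B ∧
      LinearMap.range B.toLinearMap = tangentPlane S (ψ a) :=
    ⟨_, h.immersion a ha, (h.tangentPlane_eq ha).symm⟩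
  have hF : tangentFrame S (ψ a) = hex.choose := dif_pos hex
  have hFi : Function.Injective (tangentFrame S (ψ a)) := hF ▸ hex.choose_spec.1
  have hFr : LinearMap.range (tangentFrame S (ψ a)).toLinearMap = tangentPlane S (ψ a) :=
    hF ▸ hex.choose_spec.2
  obtain ⟨τ, hτ, hdet⟩ := exists_comp_of_range_eq (B := fderiv ℝ ψ a) hFi
    (by rw [hFr, h.tangentPlane_eq ha])
  rw [areaJacobian, hτ, ← ContinuousLinearMap.comp_assoc, gramDensity_comp, gramDensity_comp,
    mul_div_mul_right _ _ (abs_ne_zero.2 hdet)]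

theorem IsLocalParam.areaJacobian_mul_areaDensity {V : Set (Eu 2)} {ψ : Eu 2 → Eu s}
    (h : IsLocalParam S V ψ) (hθ : ContDiffOn ℝ ∞ θ S) {a : Eu 2} (ha : a ∈ V) :
    areaDensity ψ a * ENNReal.ofReal (areaJacobian S θ (ψ a)) = areaDensity (θ ∘ ψ) a := by
  rw [areaDensity_eq, areaDensity_eq, ← ENNReal.ofReal_mul (gramDensity_nonneg _),
    h.areaJacobian_eq ha, mul_div_cancel₀ _ (gramDensity_pos (h.immersion a ha)).ne',
    h.fderiv_comp hθ ha]

theorem IsClosedSurface.areaJacobian_pos (hS : IsClosedSurface S) (hθ : IsDiffeoOf S θ)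
    {x : Eu s} (hx : x ∈ S) : 0 < areaJacobian S θ x := by
  obtain ⟨V, ψ, h, a, ha, rfl⟩ := hS.exists_param x hx
  rw [h.areaJacobian_eq ha, ← h.fderiv_comp hθ.smooth ha]
  exact div_pos (gramDensity_pos ((h.comp_diffeo hθ).immersion a ha))
    (gramDensity_pos (h.immersion a ha))

theorem IsClosedSurface.contDiffOn_areaJacobian (hS : IsClosedSurface S) {W : Type*}
    [NormedAddCommGroup W] [NormedSpace ℝ W] {G : Set W} {θ : W → Eu s → Eu s}
    (hθ : ContDiffOn ℝ ∞ (fun z : W × Eu s => θ z.1 z.2) (G ×ˢ S))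
    (hdiff : ∀ g ∈ G, IsDiffeoOf S (θ g)) :
    ContDiffOn ℝ ∞ (fun z : W × Eu s => areaJacobian S (θ z.1) z.2) (G ×ˢ S) := by
  rintro ⟨g, x⟩ ⟨hg : g ∈ G, hx : x ∈ S⟩
  obtain ⟨V, ψ, h, a, ha, rfl⟩ := hS.exists_param x hx
  have hB : ContDiffWithinAt ℝ ∞ (fun z : W × Eu s => fderiv ℝ ψ (Function.invFunOn ψ V z.2))
      (G ×ˢ S) (g, ψ a) :=
    ContDiffWithinAt.comp (g := fun y => fderiv ℝ ψ (Function.invFunOn ψ V y)) (t := S) (g, ψ a)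
      (h.contDiffWithinAt_fderiv_invFunOn ha) contDiffWithinAt_snd fun z hz => hz.2
  have hL := (hS.contDiffOn_fderivWithin_comp_tangentProj hθ (g, ψ a) ⟨hg, hx⟩).clm_comp hB
  have htan : ∀ y v, ψ (Function.invFunOn ψ V y) = y → Function.invFunOn ψ V y ∈ V →
      tangentProj S y (fderiv ℝ ψ (Function.invFunOn ψ V y) v) =
        fderiv ℝ ψ (Function.invFunOn ψ V y) v := fun y v hy hV => by
    refine tangentProj_of_mem ?_
    have := h.tangentPlane_eq hV
    rw [hy] at this
    rw [this]
    exact ⟨v, rfl⟩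
  have hval : ∀ z : W × Eu s, ψ (Function.invFunOn ψ V z.2) = z.2 → Function.invFunOn ψ V z.2 ∈ V →
      ((fderivWithin ℝ (θ z.1) S z.2).comp (tangentProj S z.2)).comp
        (fderiv ℝ ψ (Function.invFunOn ψ V z.2)) =
      (fderivWithin ℝ (θ z.1) S z.2).comp (fderiv ℝ ψ (Function.invFunOn ψ V z.2)) :=
    fun z hz hV => by
      ext1 v
      simp only [ContinuousLinearMap.comp_apply]
      rw [htan z.2 v hz hV]
  have hinv := h.invFunOn_apply ha
  have hinj : Function.Injective ((fderivWithin ℝ (θ g) S (ψ a)).comp (fderiv ℝ ψ a)) := by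
    rw [← h.fderiv_comp (hdiff g hg).smooth ha]
    exact (h.comp_diffeo (hdiff g hg)).immersion a ha
  have hnum := ContDiffAt.comp_contDiffWithinAt (g := gramDensity) (g, ψ a)
    (contDiffAt_gramDensity (by
      rw [hval (g, ψ a) (by simp only [hinv]) (by simp only [hinv]; exact ha)]
      simp only [hinv]
      exact hinj)) hL
  have hden := ContDiffAt.comp_contDiffWithinAt (g := gramDensity) (g, ψ a)
    (contDiffAt_gramDensity (by simp only [hinv]; exact h.immersion a ha)) hB
  refine (hnum.div hden ?_).congr_of_eventuallyEq_of_mem ?_ ⟨hg, hx⟩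
  · simp only [Function.comp_apply, hinv]
    exact (gramDensity_pos (h.immersion a ha)).ne'
  · have ht : Tendsto Prod.snd (𝓝[G ×ˢ S] (g, ψ a)) (𝓝[S] (ψ a)) :=
      tendsto_nhdsWithin_iff.2 ⟨(continuous_snd.tendsto (g, ψ a)).mono_left nhdsWithin_le_nhds,
        by filter_upwards [self_mem_nhdsWithin] with z hz using hz.2⟩
    filter_upwards [ht.eventually (h.eventually_apply_invFunOn ha)] with z hz
    simp only [Pi.div_apply, Function.comp_apply]
    rw [hval z hz.2 hz.1]
    have h1 := h.areaJacobian_eq (θ := θ z.1) hz.1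
    rwa [hz.2] at h1

theorem IsClosedSurface.contDiffOn_areaJacobian' (hS : IsClosedSurface S)
    (hθ : IsDiffeoOf S θ) : ContDiffOn ℝ ∞ (areaJacobian S θ) S :=
  contDiffOn_slice (f := fun _ : ℝ => areaJacobian S θ) (A := univ)
    (hS.contDiffOn_areaJacobian (W := ℝ) (θ := fun _ => θ)
      (hθ.smooth.comp contDiffOn_snd fun _ hz => hz.2) fun _ _ => hθ) (mem_univ 0)

theorem IsClosedSurface.aemeasurable_diffeo (hS : IsClosedSurface S) (hθ : IsDiffeoOf S θ) :
    AEMeasurable θ (areaMeasure S) :=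
  (hS.aestronglyMeasurable hθ.smooth.continuousOn).aemeasurable

/-- Pushing the area measure forward by a diffeomorphism `θ` gives it the area distortion of `θ⁻¹`
as density, since `θ⁻¹ ∘ ψ` is a parametrization whenever `ψ` is one. -/
theorem IsClosedSurface.map_areaMeasure (hS : IsClosedSurface S) (hθ : IsDiffeoOf S θ) :
    (areaMeasure S).map θ = (areaMeasure S).withDensity fun y =>
      ENNReal.ofReal (areaJacobian S (Function.invFunOn θ S) y) := by
  set η := Function.invFunOn θ S
  set J : Eu s → ℝ≥0∞ := fun y => ENNReal.ofReal (areaJacobian S η y)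
  have hm := hS.isCompact.isClosed.measurableSet
  have hJ : AEMeasurable J (areaMeasure S) :=
    (hS.aestronglyMeasurable (ENNReal.continuous_ofReal.comp_continuousOn
      (hS.contDiffOn_areaJacobian' hθ.symm).continuousOn)).aemeasurable
  have hθm := hS.aemeasurable_diffeo hθ
  -- the two measures agree on the image of each parametrization
  have hloc : ∀ (V : Set (Eu 2)) (ψ : Eu 2 → Eu s), IsLocalParam S V ψ →
      ((areaMeasure S).map θ).restrict (ψ '' V) =
        ((areaMeasure S).withDensity J).restrict (ψ '' V) := by
    intro V ψ h
    have hI := h.measurableSet_image hS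
    have h' := h.comp_diffeo hθ.symm
    have hpre : (θ ⁻¹' (ψ '' V) : Set (Eu s)) =ᵐ[areaMeasure S] ((η ∘ ψ) '' V : Set (Eu s)) := by
      filter_upwards [hS.ae_mem] with x hx
      refine propext ⟨?_, ?_⟩
      · rintro ⟨a, ha, hax⟩
        exact ⟨a, ha, by rw [Function.comp_apply, hax]; exact hθ.invFunOn_apply hx⟩
      · rintro ⟨a, ha, rfl⟩
        exact ⟨a, ha, (hθ.apply_invFunOn (h.mapsTo ha)).symm⟩
    rw [Measure.restrict_map_of_aemeasurable hθm hI, Measure.restrict_congr_set hpre,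
      h'.areaMeasure_restrict_image hS, restrict_withDensity hI, h.areaMeasure_restrict_image hS]
    have hθ' : AEMeasurable θ (paramMeasure V (η ∘ ψ)) := by
      rw [← h'.areaMeasure_restrict_image hS]; exact hθm.restrict
    have hJ' : AEMeasurable J (paramMeasure V ψ) := by
      rw [← h.areaMeasure_restrict_image hS]; exact hJ.restrict
    refine Measure.ext_of_lintegral _ fun f hf => ?_
    rw [lintegral_map' hf.aemeasurable hθ',
      lintegral_withDensity_eq_lintegral_mul₀ hJ' hf.aemeasurable,
      h.lintegral_paramMeasure (hJ'.mul hf.aemeasurable)]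
    refine (h'.lintegral_paramMeasure (hf.comp_aemeasurable hθ')).trans ?_
    refine setLIntegral_congr_fun h.isOpen.measurableSet fun a ha => ?_
    change areaDensity (η ∘ ψ) a * f (θ (η (ψ a))) = areaDensity ψ a * (J (ψ a) * f (ψ a))
    rw [← mul_assoc, h.areaJacobian_mul_areaDensity hθ.symm.smooth ha,
      hθ.apply_invFunOn (h.mapsTo ha)]
  -- finitely many of these images cover `S`, which carries both measures
  choose! V ψ hp hx using hS.exists_param
  have hnhds : ∀ x ∈ S, ψ x '' V x ∈ 𝓝[S] x := by
    intro x hxS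
    obtain ⟨a, ha, hax⟩ := hx x hxS
    have := (hp x hxS).image_mem_nhdsWithin univ_mem ha
    rwa [inter_univ, hax] at this
  obtain ⟨t, ht, htS⟩ := hS.isCompact.elim_nhdsWithin_subcover (fun x => ψ x '' V x) hnhds
  have hfin : ((areaMeasure S).map θ).restrict (⋃ x ∈ t, ψ x '' V x) =
      ((areaMeasure S).withDensity J).restrict (⋃ x ∈ t, ψ x '' V x) :=
    (Measure.restrict_biUnion_congr t.countable_toSet).2 fun x hxt =>
      hloc _ _ (hp x (ht x hxt))
  have h1 : ∀ᵐ y ∂((areaMeasure S).map θ), y ∈ ⋃ x ∈ t, ψ x '' V x := by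
    rw [ae_iff, Measure.map_apply_of_aemeasurable hθm]
    · refine measure_mono_null (fun x hx => ?_) (mem_ae_iff.1 hS.ae_mem)
      exact fun hxS => hx (htS (hθ.mapsTo hxS))
    · exact (t.measurableSet_biUnion fun x hxt => (hp x (ht x hxt)).measurableSet_image hS).compl
  have h2 : ∀ᵐ y ∂((areaMeasure S).withDensity J), y ∈ ⋃ x ∈ t, ψ x '' V x :=
    (withDensity_absolutelyContinuous _ _).ae_le (hS.ae_mem.mono fun x hxS => htS hxS)
  rwa [Measure.restrict_eq_self_of_ae_mem h1, Measure.restrict_eq_self_of_ae_mem h2] at hfin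

end

/-! ### Smooth families of functions as smooth curves of continuous functions -/

section ContinuousFamilies

variable {s : ℕ} {W E : Type} [NormedAddCommGroup W] [NormedSpace ℝ W] [NormedAddCommGroup E]
  [NormedSpace ℝ E]

open Classical in
/-- The restriction of `f` to `S` as an element of `C(S, E)`, or `0` if `f` is not continuous on
`S`. -/
noncomputable def toContinuousMapOn (S : Set (Eu s)) (f : Eu s → E) : C(S, E) :=
  if h : ContinuousOn f S then ⟨S.domRestrict f, h.domRestrict⟩ else 0

omit [NormedSpace ℝ E] in
theorem toContinuousMapOn_apply {S : Set (Eu s)} {f : Eu s → E} (hf : ContinuousOn f S) (x : S) :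
    toContinuousMapOn S f x = f x := by
  rw [toContinuousMapOn, dif_pos hf]; rfl

/-- A continuous function with values in `W → E` as an operator `W → C(S, E)`. -/
noncomputable def curryOperator (S : Set (Eu s)) [CompactSpace S] :
    C(S, W →L[ℝ] E) →L[ℝ] (W →L[ℝ] C(S, E)) :=
  LinearMap.mkContinuous₂
    (LinearMap.mk₂ ℝ (fun (F : C(S, W →L[ℝ] E)) (w : W) =>
        (⟨fun x => F x w, by fun_prop⟩ : C(S, E)))
      (fun _ _ _ => by ext; simp) (fun _ _ _ => by ext; simp)
      (fun _ _ _ => by ext; simp) (fun _ _ _ => by ext; simp)) 1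
    (fun F w => by
      rw [one_mul]
      refine (ContinuousMap.norm_le _ (by positivity)).2 fun x => ?_
      exact ((F x).le_opNorm w).trans (by gcongr; exact F.norm_coe_le_norm x))

theorem curryOperator_apply (S : Set (Eu s)) [CompactSpace S] (F : C(S, W →L[ℝ] E)) (w : W)
    (x : S) : curryOperator S F w x = F x w := rfl

omit [NormedSpace ℝ W] [NormedSpace ℝ E] in
theorem continuousOn_toContinuousMapOn {S : Set (Eu s)} {G : Set W}
    {f : W → Eu s → E} (hf : ContinuousOn (fun z : W × Eu s => f z.1 z.2) (G ×ˢ S)) :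
    ContinuousOn (fun g => toContinuousMapOn S (f g)) G := by
  rw [continuousOn_iff_continuous_domRestrict]
  let F : C(G × S, E) := ⟨fun z => f z.1 z.2, hf.comp_continuous
    (f := fun z : G × S => ((z.1 : W), (z.2 : Eu s))) (by fun_prop) fun z => ⟨z.1.2, z.2.2⟩⟩
  have h1 : G.domRestrict (fun g => toContinuousMapOn S (f g)) = F.curry := by
    ext g x
    have : ContinuousOn (f g) S := hf.comp (f := fun x => ((g : W), x)) (by fun_prop)
      fun x hx => ⟨g.2, hx⟩
    exact toContinuousMapOn_apply this x
  rw [h1]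
  exact F.curry.continuous

variable {S : Set (Eu s)} {G : Set W}

/-- The difference quotients of `g ↦ f g ·` converge uniformly on `S`, by the mean value inequality
and the uniform continuity in `g` of the partial derivative. -/
theorem hasFDerivAt_toContinuousMapOn [CompactSpace S] (hG : IsOpen G)
    {f : W → Eu s → E} (hf : ContDiffOn ℝ ∞ (fun z : W × Eu s => f z.1 z.2) (G ×ˢ S)) {g₀ : W}
    (hg₀ : g₀ ∈ G) :
    HasFDerivAt (fun g => toContinuousMapOn S (f g))
      (curryOperator S (toContinuousMapOn S fun x => fderiv ℝ (fun g => f g x) g₀)) g₀ := by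
  let D : W → Eu s → W →L[ℝ] E := fun g x => fderiv ℝ (fun g => f g x) g
  have hD : ContDiffOn ℝ ∞ (fun z : W × Eu s => D z.1 z.2) (G ×ˢ S) := contDiffOn_fderiv_left hG hf
  have hDc := (continuousOn_toContinuousMapOn hD.continuousOn).continuousAt (hG.mem_nhds hg₀)
  have hDs : ∀ g ∈ G, ContinuousOn (D g) S := fun g hg => (contDiffOn_slice hD hg).continuousOn
  have hfs : ∀ g ∈ G, ContinuousOn (f g) S := fun g hg => (contDiffOn_slice hf hg).continuousOn
  have hfd : ∀ g ∈ G, ∀ x ∈ S, HasFDerivAt (fun g => f g x) (D g x) g := fun g hg x hx => by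
    have h1 : ContDiffOn ℝ ∞ (fun g => f g x) G :=
      hf.comp (f := fun g => (g, x)) (by fun_prop) fun _ hg' => ⟨hg', hx⟩
    exact ((h1.contDiffAt (hG.mem_nhds hg)).differentiableAt (by simp)).hasFDerivAt
  rw [hasFDerivAt_iff_isLittleO, Asymptotics.isLittleO_iff]
  intro ε hε
  obtain ⟨δ, hδ, hball⟩ := Metric.mem_nhds_iff.1
    (inter_mem (hG.mem_nhds hg₀) (hDc (Metric.closedBall_mem_nhds _ hε)))
  filter_upwards [Metric.ball_mem_nhds g₀ hδ] with g hg
  refine (ContinuousMap.norm_le _ (by positivity)).2 fun x => ?_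
  rw [ContinuousMap.sub_apply, ContinuousMap.sub_apply, curryOperator_apply,
    toContinuousMapOn_apply (hfs g (hball hg).1), toContinuousMapOn_apply (hfs g₀ hg₀),
    toContinuousMapOn_apply (hDs g₀ hg₀)]
  refine Convex.norm_image_sub_le_of_norm_hasFDerivWithin_le' (𝕜 := ℝ) (f := fun g => f g x)
    (f' := fun g => D g x) (s := Metric.ball g₀ δ)
    (fun y hy => (hfd y (hball hy).1 x x.2).hasFDerivWithinAt) (fun y hy => ?_)
    (convex_ball _ _) (Metric.mem_ball_self hδ) hg
  have h1 := mem_closedBall_iff_norm.1 (hball hy).2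
  have h2 := (ContinuousMap.norm_coe_le_norm _ x).trans h1
  rwa [ContinuousMap.sub_apply, toContinuousMapOn_apply (hDs y (hball hy).1),
    toContinuousMapOn_apply (hDs g₀ hg₀)] at h2

theorem contDiffOn_toContinuousMapOn [CompactSpace S] (hG : IsOpen G)
    {f : W → Eu s → E} (hf : ContDiffOn ℝ ∞ (fun z : W × Eu s => f z.1 z.2) (G ×ˢ S)) :
    ContDiffOn ℝ ∞ (fun g => toContinuousMapOn S (f g)) G := by
  refine contDiffOn_infty.2 fun m => ?_
  induction m generalizing E with
  | zero => exact contDiffOn_zero.2 (continuousOn_toContinuousMapOn hf.continuousOn)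
  | succ m ih =>
    rw [show ((m + 1 : ℕ) : ℕ∞ω) = (m : ℕ∞ω) + 1 by push_cast; rfl]
    refine (contDiffOn_succ_iff_fderiv_of_isOpen hG).2 ⟨fun g hg =>
      (hasFDerivAt_toContinuousMapOn hG hf hg).differentiableAt.differentiableWithinAt,
      fun h => absurd h (by simp), ?_⟩
    refine ((curryOperator S).contDiff.comp_contDiffOn
      (ih (f := fun g x => fderiv ℝ (fun g => f g x) g)
        (contDiffOn_fderiv_left hG hf))).congr fun g hg => ?_
    exact (hasFDerivAt_toContinuousMapOn hG hf hg).fderiv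

end ContinuousFamilies

/-! ### Multipliers and powers of the norm on `L^p` -/

section Multiplier

variable {s : ℕ} {S : Set (Eu s)} {E F : Type} [NormedAddCommGroup E] [NormedSpace ℝ E]
  [NormedAddCommGroup F] [NormedSpace ℝ F]

open Classical in
/-- Extension by `0` of a continuous function on `S`. -/
noncomputable def extendZero (f : C(S, E)) (x : Eu s) : E := if h : x ∈ S then f ⟨x, h⟩ else 0

omit [NormedSpace ℝ E] in
theorem extendZero_of_mem (f : C(S, E)) {x : Eu s} (hx : x ∈ S) : extendZero f x = f ⟨x, hx⟩ :=
  dif_pos hx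

omit [NormedSpace ℝ E] in
theorem norm_extendZero_le [CompactSpace S] (f : C(S, E)) (x : Eu s) : ‖extendZero f x‖ ≤ ‖f‖ := by
  by_cases hx : x ∈ S
  · rw [extendZero_of_mem f hx]; exact f.norm_coe_le_norm _
  · rw [extendZero, dif_neg hx, norm_zero]; exact norm_nonneg _

omit [NormedSpace ℝ E] in
theorem continuousOn_extendZero (f : C(S, E)) : ContinuousOn (extendZero f) S := by
  rw [continuousOn_iff_continuous_domRestrict]
  have : S.domRestrict (extendZero f) = f := by
    ext x; exact extendZero_of_mem f x.2
  rw [this]; exact f.continuous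

variable {p : ℝ≥0∞} [Fact (1 ≤ p)]

omit [Fact (1 ≤ p)] in
theorem IsClosedSurface.memLp_extendZero_apply (hS : IsClosedSurface S) [CompactSpace S]
    (K : C(S, E →L[ℝ] F)) (u : Lp E p (areaMeasure S)) :
    MemLp (fun x => extendZero K x (u x)) p (areaMeasure S) := by
  refine (Lp.memLp u).of_le_mul (c := ‖K‖) ?_ (ae_of_all _ fun x => ?_)
  · exact (ContinuousLinearMap.apply ℝ F).flip.aestronglyMeasurable_comp₂
      (hS.aestronglyMeasurable (continuousOn_extendZero K)) (Lp.aestronglyMeasurable u)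
  · exact ((extendZero K x).le_opNorm _).trans (by gcongr; exact norm_extendZero_le K x)

/-- Multiplication of `L^p` functions by continuous operator-valued functions on `S`. -/
noncomputable def IsClosedSurface.multiplier (hS : IsClosedSurface S) [CompactSpace S] (E F : Type)
    [NormedAddCommGroup E] [NormedSpace ℝ E] [NormedAddCommGroup F] [NormedSpace ℝ F]
    (p : ℝ≥0∞) [Fact (1 ≤ p)] :
    C(S, E →L[ℝ] F) →L[ℝ] Lp E p (areaMeasure S) →L[ℝ] Lp F p (areaMeasure S) :=
  LinearMap.mkContinuous₂
    (LinearMap.mk₂ ℝ (fun (K : C(S, E →L[ℝ] F)) (u : Lp E p (areaMeasure S)) =>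
        (hS.memLp_extendZero_apply K u).toLp _)
      (fun K K' u => by
        ext1
        filter_upwards [(hS.memLp_extendZero_apply (K + K') u).coeFn_toLp, hS.ae_mem,
          (hS.memLp_extendZero_apply K u).coeFn_toLp, (hS.memLp_extendZero_apply K' u).coeFn_toLp,
          Lp.coeFn_add ((hS.memLp_extendZero_apply K u).toLp _)
            ((hS.memLp_extendZero_apply K' u).toLp _)] with x h1 hx h2 h3 h4
        rw [h1, h4, Pi.add_apply, h2, h3]
        simp only [extendZero_of_mem _ hx]
        rfl)
      (fun c K u => by
        ext1
        filter_upwards [(hS.memLp_extendZero_apply (c • K) u).coeFn_toLp, hS.ae_mem,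
          (hS.memLp_extendZero_apply K u).coeFn_toLp,
          Lp.coeFn_smul c ((hS.memLp_extendZero_apply K u).toLp _)] with x h1 hx h2 h4
        rw [h1, h4, Pi.smul_apply, h2]
        simp only [extendZero_of_mem _ hx]
        rfl)
      (fun K u v => by
        ext1
        filter_upwards [(hS.memLp_extendZero_apply K (u + v)).coeFn_toLp, Lp.coeFn_add u v,
          (hS.memLp_extendZero_apply K u).coeFn_toLp, (hS.memLp_extendZero_apply K v).coeFn_toLp,
          Lp.coeFn_add ((hS.memLp_extendZero_apply K u).toLp _)
            ((hS.memLp_extendZero_apply K v).toLp _)] with x h1 hx h2 h3 h4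
        rw [h1, h4, Pi.add_apply, h2, h3, hx, Pi.add_apply, map_add])
      (fun c K u => by
        ext1
        filter_upwards [(hS.memLp_extendZero_apply K (c • u)).coeFn_toLp, Lp.coeFn_smul c u,
          (hS.memLp_extendZero_apply K u).coeFn_toLp,
          Lp.coeFn_smul c ((hS.memLp_extendZero_apply K u).toLp _)] with x h1 hx h2 h4
        rw [h1, h4, Pi.smul_apply, h2, hx, Pi.smul_apply, map_smul])) 1
    (fun K u => by
      rw [one_mul]
      refine Lp.norm_le_mul_norm_of_ae_le_mul ?_
      filter_upwards [(hS.memLp_extendZero_apply K u).coeFn_toLp] with x hx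
      simp only [LinearMap.mk₂_apply]
      rw [hx]
      exact ((extendZero K x).le_opNorm _).trans (by gcongr; exact norm_extendZero_le K x))

theorem IsClosedSurface.multiplier_coeFn (hS : IsClosedSurface S) [CompactSpace S]
    {K : Eu s → E →L[ℝ] F} (hK : ContinuousOn K S) (u : Lp E p (areaMeasure S)) :
    hS.multiplier E F p (toContinuousMapOn S K) u =ᵐ[areaMeasure S] fun x => K x (u x) := by
  have h1 : hS.multiplier E F p (toContinuousMapOn S K) u =ᵐ[areaMeasure S]
      fun x => extendZero (toContinuousMapOn S K) x (u x) :=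
    (hS.memLp_extendZero_apply (toContinuousMapOn S K) u).coeFn_toLp
  filter_upwards [h1, hS.ae_mem] with x hx hxS
  rw [hx, extendZero_of_mem _ hxS, toContinuousMapOn_apply hK]

end Multiplier

section Power

variable {α : Type*} [MeasurableSpace α] {μ : Measure α} {E : Type*} [NormedAddCommGroup E]
  [NormedSpace ℝ E] {p : ℕ}

omit [NormedSpace ℝ E] in
/-- Hölder's inequality for `p` functions in `L^p`. -/
theorem lintegral_prod_enorm_le (hp : p ≠ 0) (v : Fin p → Lp E (p : ℝ≥0∞) μ) :
    ∫⁻ x, ∏ i, ‖v i x‖ₑ ∂μ ≤ ∏ i, ‖v i‖ₑ := by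
  have hp0 : (0 : ℝ) < p := by exact_mod_cast Nat.pos_of_ne_zero hp
  have h1 := ENNReal.lintegral_prod_norm_pow_le (μ := μ) (Finset.univ : Finset (Fin p))
    (f := fun i x => ‖v i x‖ₑ ^ (p : ℝ))
    (fun i _ => (Lp.aestronglyMeasurable (v i)).enorm.pow_const _) (p := fun _ => (p : ℝ)⁻¹)
    (by simp [hp0.ne']) (fun _ _ => inv_nonneg.2 hp0.le)
  have h2 : ∀ a : ℝ≥0∞, (a ^ (p : ℝ)) ^ (p : ℝ)⁻¹ = a := fun a => by
    rw [← ENNReal.rpow_mul, mul_inv_cancel₀ hp0.ne', ENNReal.rpow_one]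
  simp only [h2] at h1
  refine h1.trans_eq (Finset.prod_congr rfl fun i _ => ?_)
  rw [Lp.enorm_def, eLpNorm_eq_lintegral_rpow_enorm_toReal (by exact_mod_cast hp)
    (ENNReal.natCast_ne_top p)]
  simp

theorem integrable_multilinear_lp [SecondCountableTopology E] (hp : p ≠ 0)
    (m : ContinuousMultilinearMap ℝ (fun _ : Fin p => E) ℝ) (v : Fin p → Lp E (p : ℝ≥0∞) μ) :
    Integrable (fun x => m fun i => v i x) μ ∧
      ‖∫ x, m (fun i => v i x) ∂μ‖ ≤ ‖m‖ * ∏ i, ‖v i‖ := by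
  have hm : AEStronglyMeasurable (fun x => m fun i => v i x) μ := by
    borelize E
    exact m.cont.comp_aestronglyMeasurable (aemeasurable_pi_iff.2 fun i =>
      (Lp.aestronglyMeasurable (v i)).aemeasurable).aestronglyMeasurable
  have h1 : ∫⁻ x, ‖m fun i => v i x‖ₑ ∂μ ≤ ‖m‖ₑ * ∏ i, ‖v i‖ₑ := by
    calc ∫⁻ x, ‖m fun i => v i x‖ₑ ∂μ ≤ ∫⁻ x, ‖m‖ₑ * ∏ i, ‖v i x‖ₑ ∂μ :=
          lintegral_mono fun x => by
            have h := ENNReal.ofReal_le_ofReal (m.le_opNorm fun i => v i x)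
            rwa [ENNReal.ofReal_mul (norm_nonneg _),
              ENNReal.ofReal_prod_of_nonneg fun _ _ => norm_nonneg _, ofReal_norm, ofReal_norm,
              Finset.prod_congr rfl fun i _ => ofReal_norm (v i x)] at h
      _ = ‖m‖ₑ * ∫⁻ x, ∏ i, ‖v i x‖ₑ ∂μ := lintegral_const_mul' _ _ enorm_ne_top
      _ ≤ _ := by gcongr; exact lintegral_prod_enorm_le hp v
  have h2 : ‖m‖ₑ * ∏ i, ‖v i‖ₑ ≠ ⊤ :=
    ENNReal.mul_ne_top enorm_ne_top (ENNReal.prod_ne_top fun _ _ => enorm_ne_top)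
  refine ⟨⟨hm, h1.trans_lt h2.lt_top⟩, ?_⟩
  refine (norm_integral_le_lintegral_norm _).trans ?_
  have h3 : ∫⁻ x, ENNReal.ofReal ‖m fun i => v i x‖ ∂μ ≤ ‖m‖ₑ * ∏ i, ‖v i‖ₑ := by
    simpa only [ofReal_norm] using h1
  refine (ENNReal.toReal_mono h2 h3).trans_eq ?_
  simp [ENNReal.toReal_mul, ENNReal.toReal_prod, Lp.enorm_def, Lp.norm_def]

omit [NormedSpace ℝ E] in
theorem coeFn_update_lp (v : Fin p → Lp E (p : ℝ≥0∞) μ) (i : Fin p) (a : Lp E (p : ℝ≥0∞) μ)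
    (x : α) :
    (fun j => (Function.update v i a) j x) = Function.update (fun j => v j x) i (a x) := by
  ext1 j
  by_cases h : j = i
  · subst h; simp
  · simp [h]

variable [Fact (1 ≤ (p : ℝ≥0∞))]

/-- A continuous `p`-linear form integrates to a continuous `p`-linear form on `L^p`. -/
noncomputable def lpMultilinear [SecondCountableTopology E] (hp : p ≠ 0)
    (m : ContinuousMultilinearMap ℝ (fun _ : Fin p => E) ℝ) (μ : Measure α) :
    ContinuousMultilinearMap ℝ (fun _ : Fin p => Lp E (p : ℝ≥0∞) μ) ℝ :=
  MultilinearMap.mkContinuous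
    { toFun := fun v => ∫ x, m (fun i => v i x) ∂μ
      map_update_add' := fun {inst} v i a b => by
        have : inst = instDecidableEqFin p := Subsingleton.elim _ _
        subst this
        rw [← integral_add (integrable_multilinear_lp hp m _).1
          (integrable_multilinear_lp hp m _).1]
        refine integral_congr_ae ?_
        filter_upwards [Lp.coeFn_add a b] with x hx
        rw [coeFn_update_lp, coeFn_update_lp, coeFn_update_lp, hx, Pi.add_apply, m.map_update_add]
      map_update_smul' := fun {inst} v i c a => by
        have : inst = instDecidableEqFin p := Subsingleton.elim _ _
        subst this
        rw [← integral_smul]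
        refine integral_congr_ae ?_
        filter_upwards [Lp.coeFn_smul c a] with x hx
        rw [coeFn_update_lp, coeFn_update_lp, hx, Pi.smul_apply, m.map_update_smul] }
    ‖m‖ fun v => (integrable_multilinear_lp hp m v).2

end Power

section InnerPower

variable {α : Type*} [MeasurableSpace α] {E : Type*} [NormedAddCommGroup E]
  [InnerProductSpace ℝ E]

/-- `‖v‖^{2q} = ⟪v, v⟫^q` is the restriction to the diagonal of a multilinear form. -/
theorem exists_multilinear_eq_norm_pow (E : Type*) [NormedAddCommGroup E] [InnerProductSpace ℝ E]
    (q : ℕ) : ∃ m : ContinuousMultilinearMap ℝ (fun _ : Fin (2 * q) => E) ℝ,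
      ∀ v : E, m (fun _ => v) = ‖v‖ ^ (2 * q) := by
  induction q with
  | zero => exact ⟨ContinuousMultilinearMap.uncurry0 ℝ E 1, fun v => by simp⟩
  | succ q ih =>
    obtain ⟨m, hm⟩ := ih
    let c₁ := (continuousMultilinearCurryLeftEquiv ℝ (fun _ : Fin (2 * q + 1) => E) ℝ).symm
    let c₂ := (continuousMultilinearCurryLeftEquiv ℝ (fun _ : Fin (2 * q + 2) => E) ℝ).symm
    -- `(v, w, …) ↦ ⟪v, w⟫ * m (…)`
    let l : E →L[ℝ] (E [×(2 * q + 1)]→L[ℝ] ℝ) :=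
      (c₁.toContinuousLinearEquiv : _ →L[ℝ] _).comp
        (((ContinuousLinearMap.smulRightL ℝ E (E [×(2 * q)]→L[ℝ] ℝ)).flip m).comp (innerSL ℝ))
    refine ⟨c₂ l, fun v => ?_⟩
    have h1 : c₂ l (fun _ => v) = ⟪v, v⟫ * m (fun _ => v) := rfl
    refine h1.trans ?_
    rw [hm, real_inner_self_eq_norm_sq]
    ring

theorem contDiff_integral_norm_pow [SecondCountableTopology E] {p : ℕ}
    [Fact (1 ≤ (p : ℝ≥0∞))] (hp : p ≠ 0) (hpe : Even p) (μ : Measure α) :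
    ContDiff ℝ ∞ fun v : Lp E (p : ℝ≥0∞) μ => ∫ x, ‖v x‖ ^ p ∂μ := by
  obtain ⟨q, rfl⟩ := even_iff_exists_two_mul.1 hpe
  obtain ⟨m, hm⟩ := exists_multilinear_eq_norm_pow E q
  have h1 : (fun v : Lp E ((2 * q : ℕ) : ℝ≥0∞) μ => ∫ x, ‖v x‖ ^ (2 * q) ∂μ) =
      fun v => lpMultilinear hp m μ (fun _ => v) := by
    ext v
    exact integral_congr_ae (ae_of_all _ fun x => (hm (v x)).symm)
  rw [h1]
  exact (ContinuousMultilinearMap.contDiff _).comp (contDiff_pi.2 fun _ => contDiff_id)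

end InnerPower

/-! ### The composition operator -/

section Composition

variable {s : ℕ} {S : Set (Eu s)} {θ : Eu s → Eu s}

theorem IsClosedSurface.exists_map_areaMeasure_le (hS : IsClosedSurface S) (hθ : IsDiffeoOf S θ) :
    ∃ c : ℝ≥0∞, c ≠ ⊤ ∧ (areaMeasure S).map θ ≤ c • areaMeasure S := by
  obtain ⟨c, hc⟩ := hS.isCompact.bddAbove_image
    (hS.contDiffOn_areaJacobian' hθ.symm).continuousOn
  refine ⟨ENNReal.ofReal c, ENNReal.ofReal_ne_top, ?_⟩
  rw [hS.map_areaMeasure hθ, ← withDensity_const]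
  refine withDensity_mono ?_
  filter_upwards [hS.ae_mem] with x hx
  exact ENNReal.ofReal_le_ofReal (hc (mem_image_of_mem _ hx))

theorem IsClosedSurface.map_areaMeasure_ac (hS : IsClosedSurface S) (hθ : IsDiffeoOf S θ) :
    (areaMeasure S).map θ ≪ areaMeasure S := by
  rw [hS.map_areaMeasure hθ]
  exact withDensity_absolutelyContinuous _ _

theorem IsClosedSurface.ae_comp (hS : IsClosedSurface S) (hθ : IsDiffeoOf S θ)
    {q : Eu s → Prop} (hq : ∀ᵐ x ∂(areaMeasure S), q x) : ∀ᵐ x ∂(areaMeasure S), q (θ x) :=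
  ae_of_ae_map (hS.aemeasurable_diffeo hθ) ((hS.map_areaMeasure_ac hθ).ae_le hq)

theorem IsClosedSurface.exists_eLpNorm_comp_le (hS : IsClosedSurface S) (hθ : IsDiffeoOf S θ)
    {E : Type*} [NormedAddCommGroup E] (p : ℝ≥0∞) [Fact (1 ≤ p)] :
    ∃ c : ℝ≥0∞, c ≠ ⊤ ∧ ∀ u : Eu s → E, AEStronglyMeasurable u (areaMeasure S) →
      eLpNorm (u ∘ θ) p (areaMeasure S) ≤ c * eLpNorm u p (areaMeasure S) := by
  obtain ⟨c, hc, hle⟩ := hS.exists_map_areaMeasure_le hθ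
  refine ⟨c ^ (1 / p).toReal, ENNReal.rpow_ne_top_of_nonneg ENNReal.toReal_nonneg hc,
    fun u hu => ?_⟩
  rw [← eLpNorm_map_measure (hu.mono_ac (hS.map_areaMeasure_ac hθ)) (hS.aemeasurable_diffeo hθ)]
  refine (eLpNorm_mono_measure u hle).trans ?_
  by_cases hc0 : c = 0
  · subst hc0
    rw [zero_smul, eLpNorm_measure_zero]
    exact zero_le
  · rw [eLpNorm_smul_measure_of_ne_zero hc0, smul_eq_mul]

/-- Composition with a diffeomorphism as an operator on `L^p`. -/
theorem IsClosedSurface.exists_compLp (hS : IsClosedSurface S) (hθ : IsDiffeoOf S θ)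
    (E : Type*) [NormedAddCommGroup E] [NormedSpace ℝ E] (p : ℝ≥0∞) [Fact (1 ≤ p)] :
    ∃ B : Lp E p (areaMeasure S) →L[ℝ] Lp E p (areaMeasure S),
      ∀ u, B u =ᵐ[areaMeasure S] fun x => u (θ x) := by
  obtain ⟨c, hc, hle⟩ := hS.exists_eLpNorm_comp_le (E := E) hθ p
  have hm : ∀ u : Lp E p (areaMeasure S), MemLp (u ∘ θ) p (areaMeasure S) := fun u =>
    ⟨((Lp.aestronglyMeasurable u).mono_ac (hS.map_areaMeasure_ac hθ)).comp_aemeasurable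
      (hS.aemeasurable_diffeo hθ), (hle u (Lp.aestronglyMeasurable u)).trans_lt
        (ENNReal.mul_lt_top hc.lt_top (Lp.eLpNorm_lt_top u))⟩
  let B : Lp E p (areaMeasure S) →ₗ[ℝ] Lp E p (areaMeasure S) :=
    { toFun := fun u => (hm u).toLp _
      map_add' := fun u v => by
        ext1
        filter_upwards [(hm (u + v)).coeFn_toLp, hS.ae_comp hθ (Lp.coeFn_add u v),
          (hm u).coeFn_toLp, (hm v).coeFn_toLp,
          Lp.coeFn_add ((hm u).toLp _) ((hm v).toLp _)] with x h1 h2 h3 h4 h5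
        rw [h1, h5, Pi.add_apply, h3, h4, Function.comp_apply, h2]
        rfl
      map_smul' := fun c u => by
        ext1
        filter_upwards [(hm (c • u)).coeFn_toLp, hS.ae_comp hθ (Lp.coeFn_smul c u),
          (hm u).coeFn_toLp, Lp.coeFn_smul c ((hm u).toLp _)] with x h1 h2 h3 h5
        rw [h1, Function.comp_apply, h2, RingHom.id_apply, h5]
        change c • u (θ x) = c • _
        rw [h3, Function.comp_apply] }
  refine ⟨B.mkContinuous c.toReal fun u => ?_, fun u => (hm u).coeFn_toLp⟩
  change ‖(hm u).toLp _‖ ≤ _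
  rw [Lp.norm_toLp, Lp.norm_def, ← ENNReal.toReal_mul]
  exact ENNReal.toReal_mono (ENNReal.mul_ne_top hc (Lp.eLpNorm_ne_top u))
    (hle u (Lp.aestronglyMeasurable u))

end Composition

/-- `tensorComp` as a continuous linear map. -/
noncomputable def tensorCompL (s M i : ℕ) : Tens s M i →L[ℝ] TensorComp s M i :=
  (PiLp.continuousLinearEquiv 2 ℝ fun _ : Fin i → Fin s => Eu M).symm.toContinuousLinearMap.comp
    (ContinuousLinearMap.pi fun J : Fin i → Fin s =>
      ContinuousMultilinearMap.apply ℝ (fun _ : Fin i => Eu s) (Eu M) fun a =>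
        EuclideanSpace.single (J a) 1)

theorem tensorCompL_apply {s M i : ℕ} (T : Tens s M i) : tensorCompL s M i T = tensorComp T := rfl

theorem exists_leftInverse_tensorCompL (s M i : ℕ) :
    ∃ l : TensorComp s M i →L[ℝ] Tens s M i, ∀ T, l (tensorCompL s M i T) = T := by
  refine ContinuousLinearMap.exists_leftInverse_of_finiteDimensional fun T T' h => ?_
  apply ContinuousMultilinearMap.toMultilinearMap_injective
  refine Module.Basis.ext_multilinear (fun _ => (EuclideanSpace.basisFun (Fin s) ℝ).toBasis)
    fun J => ?_
  have h1 : T (fun a => EuclideanSpace.single (J a) 1) =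
      T' fun a => EuclideanSpace.single (J a) 1 := congrArg (fun w => w.ofLp J) h
  simpa using h1

theorem coeFn_sum_lp {α ι E : Type*} [MeasurableSpace α] {μ : Measure α} [NormedAddCommGroup E]
    {p : ℝ≥0∞} (t : Finset ι) (f : ι → Lp E p μ) :
    (∑ j ∈ t, f j : Lp E p μ) =ᵐ[μ] fun x => ∑ j ∈ t, f j x := by
  classical
  induction t using Finset.induction_on with
  | empty =>
    simp only [Finset.sum_empty]
    exact Lp.coeFn_zero E p μ
  | insert a t ha ih =>
    rw [Finset.sum_insert ha]
    filter_upwards [Lp.coeFn_add (f a) (∑ j ∈ t, f j), ih] with x h1 h2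
    rw [h1, Pi.add_apply, h2, Finset.sum_insert ha]

section Operator

variable {s n k M p : ℕ} {S : Set (Eu s)} {G : Set (Eu n)} {φ : Eu n → Eu s → Eu s}

/-- The chain rule in components: the jet of `h ∘ φ_g` up to order `k` is a matrix of smooth
coefficients applied to the jet of `h` along `φ_g`. -/
theorem IsClosedSurface.exists_tensorComp_iterCovDeriv_comp (hS : IsClosedSurface S) (k M : ℕ)
    (hφ : ContDiffOn ℝ ∞ (fun z : Eu n × Eu s => φ z.1 z.2) (G ×ˢ S))
    (hmap : ∀ g ∈ G, MapsTo (φ g) S S) :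
    ∃ D : (i j : Fin (k + 1)) → Eu n → Eu s → TensorComp s M j →L[ℝ] TensorComp s M i,
      (∀ i j, ContDiffOn ℝ ∞ (fun z : Eu n × Eu s => D i j z.1 z.2) (G ×ˢ S)) ∧
      ∀ i : Fin (k + 1), ∀ g ∈ G, ∀ h : Eu s → Eu M, ContDiffOn ℝ ∞ h S → ∀ x ∈ S,
        tensorComp (iterCovDeriv S (h ∘ φ g) i x) =
          ∑ j, D i j g x (tensorComp (iterCovDeriv S h j (φ g x))) := by
  choose C hC hCh using (covariantTower_iterCovDeriv hS M).exists_jet_comp hS hφ hmap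
  choose l hl using exists_leftInverse_tensorCompL s M
  refine ⟨fun i j g x => if (j : ℕ) ≤ i then
    (tensorCompL s M i).comp ((C i j g x).comp (l j)) else 0, fun i j => ?_,
    fun i g hg h hh x hx => ?_⟩
  · by_cases hij : (j : ℕ) ≤ i
    · simpa only [hij, if_true] using
        contDiffOn_const.clm_comp ((hC i j).clm_comp contDiffOn_const)
    · simpa only [hij, if_false] using contDiffOn_const
  · rw [hCh i g hg h hh x hx, ← tensorCompL_apply, map_sum]
    have h1 : ∀ j : Fin (k + 1), (if (j : ℕ) ≤ i then
        (tensorCompL s M i).comp ((C i j g x).comp (l j)) else 0)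
          (tensorComp (iterCovDeriv S h j (φ g x))) =
        (fun j : ℕ => if j ≤ i then tensorCompL s M i (C i j g x (iterCovDeriv S h j (φ g x)))
          else 0) j := fun j => by
      by_cases hij : (j : ℕ) ≤ i
      · simp only [hij, if_true, ContinuousLinearMap.comp_apply, ← tensorCompL_apply, hl]
      · simp only [hij, if_false, zero_apply]
    rw [Finset.sum_congr rfl fun j _ => h1 j, Fin.sum_univ_eq_sum_range (fun j : ℕ =>
      if j ≤ i then tensorCompL s M i (C i j g x (iterCovDeriv S h j (φ g x))) else 0) (k + 1)]
    rw [← Finset.sum_subset (Finset.range_subset_range.2 i.2)]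
    · refine Finset.sum_congr rfl fun j hj => ?_
      rw [if_pos (Nat.lt_succ_iff.1 (Finset.mem_range.1 hj))]
    · intro j _ hj
      rw [if_neg fun h => hj (Finset.mem_range.2 (Nat.lt_succ_iff.2 h))]

variable [Fact (1 ≤ (p : ℝ≥0∞))]

/-- The operator on families of `L^p` tensor fields given by a diffeomorphism `θ` and a matrix of
continuous coefficients. -/
theorem IsClosedSurface.exists_jetOperator (hS : IsClosedSurface S) {θ : Eu s → Eu s}
    (hθ : IsDiffeoOf S θ)
    {D : (i j : Fin (k + 1)) → Eu s → TensorComp s M j →L[ℝ] TensorComp s M i}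
    (hD : ∀ i j, ContinuousOn (D i j) S) :
    ∃ A : TensorJets S k p M →L[ℝ] TensorJets S k p M, ∀ u i,
      A u i =ᵐ[areaMeasure S] fun x => ∑ j, D i j x (u j (θ x)) := by
  have : CompactSpace S := isCompact_iff_compactSpace.1 hS.isCompact
  choose B hB using fun j : Fin (k + 1) => hS.exists_compLp hθ (TensorComp s M j) (p : ℝ≥0∞)
  let c : (i j : Fin (k + 1)) → TensorJets S k p M →L[ℝ] Lp (TensorComp s M i) p (areaMeasure S) :=
    fun i j => (hS.multiplier _ _ p (toContinuousMapOn S (D i j))).comp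
      ((B j).comp (PiLp.proj (p : ℝ≥0∞) _ j))
  let e := (PiLp.continuousLinearEquiv (p : ℝ≥0∞) ℝ
    fun i : Fin (k + 1) => Lp (TensorComp s M i) (p : ℝ≥0∞) (areaMeasure S)).symm
  refine ⟨e.toContinuousLinearMap.comp
    (ContinuousLinearMap.pi fun i => ∑ j, c i j), fun u i => ?_⟩
  have h1 : (e.toContinuousLinearMap.comp (ContinuousLinearMap.pi fun i => ∑ j, c i j) u) i =
      ∑ j, c i j u := by
    change (∑ j, c i j) u = _
    rw [sum_apply]
  rw [h1]
  have h2 : ∀ᵐ x ∂(areaMeasure S), ∀ j, c i j u x = D i j x (u j (θ x)) :=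
    ae_all_iff.2 fun j => by
      filter_upwards [hS.multiplier_coeFn (p := (p : ℝ≥0∞)) (hD i j) (B j (u j)), hB j (u j)]
        with x h3 h4
      rw [← h4, ← h3]
      rfl
  filter_upwards [coeFn_sum_lp Finset.univ (fun j => c i j u), h2] with x h3 h4
  rw [h3]
  exact Finset.sum_congr rfl fun j _ => h4 j

end Operator

/-! ### The Sobolev space -/

section Sobolev

variable {s n k M p : ℕ} {S : Set (Eu s)} {G : Set (Eu n)} {φ : Eu n → Eu s → Eu s}
  [Fact (1 ≤ (p : ℝ≥0∞))]

theorem sobolevSubmodule_le {N : Submodule ℝ (TensorJets S k p M)}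
    (hN : IsClosed (N : Set (TensorJets S k p M)))
    (h : ∀ u : TensorJets S k p M, ∀ f : Eu s → Eu M, ContDiffOn ℝ ∞ f S → IsJetOf u f → u ∈ N) :
    sobolevSubmodule S k p M ≤ N :=
  Submodule.topologicalClosure_minimal _
    (Submodule.span_le.2 fun u ⟨f, hf, hu⟩ => h u f hf hu) hN

theorem IsJetOf.mem_sobolevSubmodule {u : TensorJets S k p M} {f : Eu s → Eu M}
    (hu : IsJetOf u f) (hf : ContDiffOn ℝ ∞ f S) : u ∈ sobolevSubmodule S k p M :=
  Submodule.le_topologicalClosure _ (Submodule.subset_span ⟨f, hf, hu⟩)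

/-- Two bounded operators that agree on the jets of smooth functions are equal. -/
theorem Sobolev.ext_of_jets {A B : Sobolev S k p M →L[ℝ] TensorJets S k p M}
    (h : ∀ f : Sobolev S k p M, ∀ q : Eu s → Eu M, ContDiffOn ℝ ∞ q S → IsJetOf f.1 q →
      A f = B f) : A = B := by
  have hcl : IsClosed (sobolevSubmodule S k p M : Set (TensorJets S k p M)) :=
    Submodule.isClosed_topologicalClosure _
  let N : Submodule ℝ (TensorJets S k p M) :=
    (LinearMap.ker (A - B).toLinearMap).map (sobolevSubmodule S k p M).subtype
  have hN : IsClosed (N : Set (TensorJets S k p M)) :=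
    hcl.isClosedEmbedding_subtypeVal.isClosedMap _ (A - B).isClosed_ker
  have hle : sobolevSubmodule S k p M ≤ N := sobolevSubmodule_le hN fun u q hq hu =>
    ⟨⟨u, hu.mem_sobolevSubmodule hq⟩, sub_eq_zero.2 (h ⟨u, hu.mem_sobolevSubmodule hq⟩ q hq hu),
      rfl⟩
  ext1 f
  obtain ⟨f', hf', he⟩ := hle f.2
  have : f' = f := Subtype.ext he
  subst this
  exact sub_eq_zero.1 hf'

/-- If an operator on families of tensor fields acts on the jets of smooth functions as composition
with `θ`, then it preserves `L^p_k` and its restriction is the only composition operator. -/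
theorem IsClosedSurface.existsUnique_compositionOperator (hS : IsClosedSurface S)
    {θ : Eu s → Eu s} (hθ : IsDiffeoOf S θ) {A : TensorJets S k p M →L[ℝ] TensorJets S k p M}
    (hA : ∀ u : TensorJets S k p M, ∀ f : Eu s → Eu M, ContDiffOn ℝ ∞ f S → IsJetOf u f →
      IsJetOf (A u) (f ∘ θ)) :
    (∃ B : Sobolev S k p M →L[ℝ] Sobolev S k p M, IsCompositionOperator θ B) ∧
      ∀ B : Sobolev S k p M →L[ℝ] Sobolev S k p M, IsCompositionOperator θ B →
        ∀ f, (B f).1 = A f.1 := by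
  have hcomp : ∀ f : Eu s → Eu M, ContDiffOn ℝ ∞ f S → ContDiffOn ℝ ∞ (f ∘ θ) S := fun f hf =>
    hf.comp hθ.smooth hθ.mapsTo
  have hmem : ∀ u ∈ sobolevSubmodule S k p M, A u ∈ sobolevSubmodule S k p M := by
    have hcl : IsClosed (sobolevSubmodule S k p M : Set (TensorJets S k p M)) :=
      Submodule.isClosed_topologicalClosure _
    have hle : sobolevSubmodule S k p M ≤ (sobolevSubmodule S k p M).comap A.toLinearMap :=
      sobolevSubmodule_le (hcl.preimage A.continuous) fun u f hf hu =>
        (hA u f hf hu).mem_sobolevSubmodule (hcomp f hf)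
    exact hle
  constructor
  · let B : Sobolev S k p M →L[ℝ] Sobolev S k p M :=
      (A.comp (sobolevSubmodule S k p M).subtypeL).codRestrict _ fun f => hmem f.1 f.2
    obtain ⟨C, hC⟩ := hS.exists_compLp hθ (TensorComp s M (0 : Fin (k + 1))) (p : ℝ≥0∞)
    -- on functions, `A` acts as composition with `θ`, because it does so on smooth ones
    have hle : sobolevSubmodule S k p M ≤ LinearMap.ker
        ((PiLp.proj (p : ℝ≥0∞) (𝕜 := ℝ) (fun i : Fin (k + 1) =>
          Lp (TensorComp s M i) (p : ℝ≥0∞) (areaMeasure S)) 0).comp A -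
        C.comp (PiLp.proj (p : ℝ≥0∞) (𝕜 := ℝ) (fun i : Fin (k + 1) =>
          Lp (TensorComp s M i) (p : ℝ≥0∞) (areaMeasure S)) 0)).toLinearMap := by
      refine sobolevSubmodule_le (ContinuousLinearMap.isClosed_ker _) fun u f hf hu => ?_
      refine sub_eq_zero.2 ?_
      change A u 0 = C (u 0)
      ext1
      filter_upwards [hA u f hf hu 0, hC (u 0), hS.ae_comp hθ (hu 0)] with x h1 h2 h3
      rw [h1, h2, h3]
      rfl
    refine ⟨B, fun f => ?_, fun f q hq hf => hA f.1 q hq hf⟩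
    have h1 : A f.1 0 = C (f.1 0) := sub_eq_zero.1 (hle f.2)
    filter_upwards [hC (f.1 0)] with x hx
    change (A f.1 0 x) Fin.elim0 = (f.1 0 (θ x)) Fin.elim0
    rw [h1, hx]
  · intro B hB f
    have h1 : (sobolevSubmodule S k p M).subtypeL.comp B =
        A.comp (sobolevSubmodule S k p M).subtypeL := by
      refine Sobolev.ext_of_jets fun f q hq hf => ?_
      refine PiLp.ext fun i => ?_
      change (B f).1 i = A f.1 i
      ext1
      filter_upwards [hB.jet_eq f q hq hf i, hA f.1 q hq hf i] with x h2 h3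
      rw [h2, h3]
    exact DFunLike.congr_fun h1 f

theorem IsClosedSurface.isJetOf_comp (hS : IsClosedSurface S) {θ : Eu s → Eu s}
    (hθ : IsDiffeoOf S θ) {A : TensorJets S k p M →L[ℝ] TensorJets S k p M}
    {D : (i j : Fin (k + 1)) → Eu s → TensorComp s M j →L[ℝ] TensorComp s M i}
    (hA : ∀ u i, A u i =ᵐ[areaMeasure S] fun x => ∑ j, D i j x (u j (θ x)))
    {f : Eu s → Eu M} (hD : ∀ i : Fin (k + 1), ∀ x ∈ S, tensorComp (iterCovDeriv S (f ∘ θ) i x) =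
      ∑ j, D i j x (tensorComp (iterCovDeriv S f j (θ x)))) {u : TensorJets S k p M}
    (hu : IsJetOf u f) : IsJetOf (A u) (f ∘ θ) := fun i => by
  have h1 : ∀ᵐ x ∂(areaMeasure S), ∀ j : Fin (k + 1),
      u j (θ x) = tensorComp (iterCovDeriv S f j (θ x)) :=
    ae_all_iff.2 fun j => hS.ae_comp hθ (hu j)
  filter_upwards [hA u i, h1, hS.ae_mem] with x h2 h3 hx
  rw [h2, hD i x hx]
  exact Finset.sum_congr rfl fun j _ => by rw [h3 j]

/-- Change of variables `y = θ x` in `∫ |∑_j D_j(x) u_j(θ x)|^p`.  The Jacobian is absorbed into the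
coefficients, which become `J^{1/p} D_j ∘ θ⁻¹`. -/
theorem IsClosedSurface.integral_norm_pow_comp (hS : IsClosedSurface S) [CompactSpace S]
    {θ : Eu s → Eu s} (hθ : IsDiffeoOf S θ) (hp : p ≠ 0) {ι F : Type} [Fintype ι] {E : ι → Type}
    [∀ j, NormedAddCommGroup (E j)] [∀ j, NormedSpace ℝ (E j)] [NormedAddCommGroup F]
    [NormedSpace ℝ F] {D : (j : ι) → Eu s → E j →L[ℝ] F} (hD : ∀ j, ContinuousOn (D j) S)
    (u : (j : ι) → Lp (E j) (p : ℝ≥0∞) (areaMeasure S)) :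
    ∫ x, ‖∑ j, D j x (u j (θ x))‖ ^ p ∂(areaMeasure S) =
      ∫ y, ‖(∑ j, hS.multiplier (E j) F p (toContinuousMapOn S fun y =>
        areaJacobian S (Function.invFunOn θ S) y ^ (p : ℝ)⁻¹ •
          D j (Function.invFunOn θ S y)) (u j) : Lp F (p : ℝ≥0∞) (areaMeasure S)) y‖ ^ p
            ∂(areaMeasure S) := by
  set η := Function.invFunOn θ S
  set J := areaJacobian S η
  have hJ : ContinuousOn J S := (hS.contDiffOn_areaJacobian' hθ.symm).continuousOn
  have hJm : AEMeasurable (fun y => ENNReal.ofReal (J y)) (areaMeasure S) :=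
    (hS.aestronglyMeasurable (ENNReal.continuous_ofReal.comp_continuousOn hJ)).aemeasurable
  have hDη : ∀ j, ContinuousOn (fun y => D j (η y)) S := fun j =>
    (hD j).comp hθ.symm.smooth.continuousOn hθ.symm.mapsTo
  have hK : ∀ j, ContinuousOn (fun y => J y ^ (p : ℝ)⁻¹ • D j (η y)) S := fun j =>
    (hJ.rpow_const fun y hy => Or.inr (by positivity)).smul (hDη j)
  -- the integrand is `q ∘ θ`
  let q : Eu s → ℝ := fun y => ‖∑ j, D j (η y) (u j y)‖ ^ p
  have hqm : AEStronglyMeasurable q (areaMeasure S) := by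
    have h1 : AEStronglyMeasurable (fun y => ∑ j, D j (η y) (u j y)) (areaMeasure S) := by
      refine Finset.aestronglyMeasurable_fun_sum _ fun j _ => ?_
      exact (Lp.aestronglyMeasurable _).congr
        (hS.multiplier_coeFn (p := (p : ℝ≥0∞)) (hDη j) (u j))
    exact h1.norm.pow p
  have h2 : ∫ x, ‖∑ j, D j x (u j (θ x))‖ ^ p ∂(areaMeasure S) =
      ∫ x, q (θ x) ∂(areaMeasure S) := by
    refine integral_congr_ae ?_
    filter_upwards [hS.ae_mem] with x hx
    simp only [q, η, hθ.invFunOn_apply hx]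
  rw [h2, ← integral_map (hS.aemeasurable_diffeo hθ) (hqm.mono_ac (hS.map_areaMeasure_ac hθ)),
    hS.map_areaMeasure hθ, integral_withDensity_eq_integral_toReal_smul₀ hJm
    (ae_of_all _ fun _ => ENNReal.ofReal_lt_top)]
  refine integral_congr_ae ?_
  have h3 : ∀ᵐ y ∂(areaMeasure S), ∀ j, hS.multiplier (E j) F p (toContinuousMapOn S fun y =>
      J y ^ (p : ℝ)⁻¹ • D j (η y)) (u j) y = (J y ^ (p : ℝ)⁻¹ • D j (η y)) (u j y) :=
    ae_all_iff.2 fun j => hS.multiplier_coeFn (p := (p : ℝ≥0∞)) (hK j) (u j)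
  filter_upwards [h3, coeFn_sum_lp Finset.univ fun j => hS.multiplier (E j) F p
    (toContinuousMapOn S fun y => J y ^ (p : ℝ)⁻¹ • D j (η y)) (u j)] with y h4 h5
  have hJy : 0 ≤ J y := areaJacobian_nonneg y
  rw [h5, Finset.sum_congr rfl fun j _ => h4 j]
  simp only [smul_apply, ← Finset.smul_sum, q]
  rw [norm_smul, mul_pow, Real.norm_of_nonneg (Real.rpow_nonneg hJy _),
    Real.rpow_inv_natCast_pow hJy hp, ENNReal.toReal_ofReal hJy, smul_eq_mul]

end Sobolev

/-! ### Smoothness of the energy of the composition -/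

theorem theorem5p2
    {s : ℕ} {S : Set (Eu s)} (hS : IsClosedSurface S)
    {o : Eu s → Eu s [⋀^Fin 2]→L[ℝ] ℝ} (ho : IsOrientation S o)
    (k M p : ℕ) [Fact (1 ≤ (p : ℝ≥0∞))] (hp : 0 < p) (hpe : Even p)
    {n : ℕ} {G : Set (Eu n)} (hG : IsOpen G)
    {φ : Eu n → Eu s → Eu s}
    (hφ : ContDiffOn ℝ ∞ (fun z : Eu n × Eu s => φ z.1 z.2) (G ×ˢ S))
    (hdiff : ∀ g ∈ G, IsDiffeoOf S (φ g))
    (hor : ∀ g ∈ G, PreservesOrientation S o (φ g)) :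
    (∀ g ∈ G, ∃! A : Sobolev S k p M →L[ℝ] Sobolev S k p M, IsCompositionOperator (φ g) A) ∧
    ∀ Φ : Eu n → (Sobolev S k p M →L[ℝ] Sobolev S k p M),
      (∀ g ∈ G, IsCompositionOperator (φ g) (Φ g)) →
      ContDiffOn ℝ ∞ (fun z : Eu n × Sobolev S k p M => sobolevN (Φ z.1 z.2)) (G ×ˢ univ) := by
  have : CompactSpace S := isCompact_iff_compactSpace.1 hS.isCompact
  obtain ⟨D, hD, hDh⟩ := hS.exists_tensorComp_iterCovDeriv_comp k M hφ
    fun g hg => (hdiff g hg).mapsTo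
  have hDg : ∀ g ∈ G, ∀ i j, ContinuousOn (D i j g) S := fun g hg i j =>
    (contDiffOn_slice (hD i j) hg).continuousOn
  have hex : ∀ g ∈ G, ∃ A : TensorJets S k p M →L[ℝ] TensorJets S k p M, ∀ u i,
      A u i =ᵐ[areaMeasure S] fun x => ∑ j, D i j g x (u j (φ g x)) := fun g hg =>
    hS.exists_jetOperator (hdiff g hg) (hDg g hg)
  choose! A hA using hex
  have hmain : ∀ g ∈ G, _ := fun g hg => hS.existsUnique_compositionOperator (k := k) (M := M)
    (p := p) (hdiff g hg) (A := A g) fun u f hf hu =>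
      hS.isJetOf_comp (hdiff g hg) (hA g hg) (fun i x hx => hDh i g hg f hf x hx) hu
  refine ⟨fun g hg => ?_, fun Φ hΦ => ?_⟩
  · obtain ⟨B, hB⟩ := (hmain g hg).1
    refine ⟨B, hB, fun B' hB' => ?_⟩
    ext1 f
    exact Subtype.ext (((hmain g hg).2 B' hB' f).trans ((hmain g hg).2 B hB f).symm)
  · let θ : Eu n → Eu s → Eu s := fun g => Function.invFunOn (φ g) S
    have hθ : ContDiffOn ℝ ∞ (fun z : Eu n × Eu s => θ z.1 z.2) (G ×ˢ S) :=
      hS.contDiffOn_invFunOn hG hφ hdiff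
    let K : (i j : Fin (k + 1)) → Eu n → Eu s → TensorComp s M j →L[ℝ] TensorComp s M i :=
      fun i j g y => areaJacobian S (θ g) y ^ (p : ℝ)⁻¹ • D i j g (θ g y)
    have hK : ∀ i j, ContDiffOn ℝ ∞ (fun g => toContinuousMapOn S (K i j g)) G := fun i j => by
      have hJ : ContDiffOn ℝ ∞ (fun z : Eu n × Eu s => areaJacobian S (θ z.1) z.2 ^ (p : ℝ)⁻¹)
          (G ×ˢ S) :=
        (hS.contDiffOn_areaJacobian hθ fun g hg => (hdiff g hg).symm).rpow_const_of_ne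
          fun z hz => (hS.areaJacobian_pos (hdiff z.1 hz.1).symm hz.2).ne'
      have hDθ : ContDiffOn ℝ ∞ (fun z : Eu n × Eu s => D i j z.1 (θ z.1 z.2)) (G ×ˢ S) :=
        (hD i j).comp (contDiffOn_fst.prodMk hθ)
          fun z hz => ⟨hz.1, (hdiff z.1 hz.1).mapsTo_invFunOn hz.2⟩
      exact contDiffOn_toContinuousMapOn hG (f := K i j) (hJ.smul hDθ)
    have hF : ∀ z ∈ G ×ˢ (univ : Set (Sobolev S k p M)), sobolevN (Φ z.1 z.2) =
        ∑ i : Fin (k + 1), ∫ y, ‖(∑ j, hS.multiplier _ (TensorComp s M i) p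
          (toContinuousMapOn S (K i j z.1)) (z.2.1 j) :
            Lp (TensorComp s M i) (p : ℝ≥0∞) (areaMeasure S)) y‖ ^ p ∂(areaMeasure S) := by
      rintro ⟨g, f⟩ ⟨hg : g ∈ G, -⟩
      refine Finset.sum_congr rfl fun i _ => ?_
      rw [(hmain g hg).2 (Φ g) (hΦ g hg) f,
        ← hS.integral_norm_pow_comp (hdiff g hg) hp.ne' (fun j => hDg g hg i j) fun j => f.1 j]
      refine integral_congr_ae ?_
      filter_upwards [hA g hg f.1 i] with x hx
      rw [hx]
    refine ContDiffOn.congr ?_ hF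
    refine ContDiffOn.sum fun i _ => ?_
    refine (contDiff_integral_norm_pow hp.ne' hpe (areaMeasure S)).comp_contDiffOn ?_
    refine ContDiffOn.sum fun j _ => ?_
    refine ContDiffOn.clm_apply ?_ ?_
    · exact (ContinuousLinearMap.contDiff _).comp_contDiffOn
        ((hK i j).comp contDiffOn_fst fun z hz => hz.1)
    · exact (((PiLp.proj (p : ℝ≥0∞) (𝕜 := ℝ) (fun i : Fin (k + 1) =>
        Lp (TensorComp s M i) (p : ℝ≥0∞) (areaMeasure S)) j).comp
          ((sobolevSubmodule S k p M).subtypeL.comp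
            (ContinuousLinearMap.snd ℝ (Eu n) (Sobolev S k p M)))).contDiff).contDiffOn
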